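/- Consider a vehicle whose attitude $R(t)\in SO(3)$ and inertial-frame velocity $v(t)\in\mathbb R^3$ satisfy, for $t\ge 0$, $$\dot R = R\,\omega^\times,\qquad \dot v = R a + g e_3,$$ where $\omega(t)$ is the body-frame angular velocity, $a(t)$ the specific acceleration, $g$ the gravity constant, $e_3=(0,0,1)^\top$, and $u^\times w=u\times w$. Put $v^{\mathcal B}=R^\top v$, $g^{\mathcal B}=R^\top g e_3$, and for $u\ne0$ let $\pi_u=I_3-uu^\top/|u|^2$. Assume $v(t)\neq0$ for all $t\ge0$, and let $\eta_v=R^\top v/|v|$ be the measured body-frame velocity direction and $\eta_v^{\mathcal I}=R\eta_v$. Let $$A(t)=\begin{bmatrix}-\omega^\times & I_3\\ 0 & -\omega^\times\end{bmatrix}\in\mathbb R^{6\times6},\qquad C(t)=\begin{bmatrix}\pi_{\eta_v} & 0\end{bmatrix}\in\mathbb R^{3\times6}.$$ Assume that $v^{\mathcal B}$ and $\omega$ are continuous and bounded on $[0,\infty)$, and that $\eta_v^{\mathcal I}$ is persistently exciting: there are $\delta,\bar\mu>0$ such that for all $t\ge0$ $$\frac1\delta\int_t^{t+\delta}\pi_{\eta_v^{\mathcal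 I}(\tau)}\,d\tau\ \ge\ \bar\mu I_3 .$$ Then: (1) The pair $(A(t),C(t))$ is uniformly observable: there are $\delta',\mu'>0$ such that for all $t\ge0$ $$\frac1{\delta'}\int_t^{t+\delta'}\Phi(s,t)^\top C(s)^\top C(s)\Phi(s,t)\,ds\ \ge\ \mu' I_6,$$ where $\Phi$ is the transition matrix of $A$, i.e. $\frac{\partial}{\partial s}\Phi(s,t)=A(s)\Phi(s,t)$ for $s\ge t$ and $\Phi(t,t)=I_6$. (2) Let $S(t)\in\mathbb R^{6\times6}$ and $D(t)\in\mathbb R^{3\times3}$ be continuous, bounded and uniformly positive definite symmetric matrix-valued functions ($S(t)\ge\varepsilon I_6$ and $D(t)\ge\varepsilon I_3$ for all $t\ge0$, for some $\varepsilon>0$), let $P$ be a solution on $[0,\infty)$ of the Riccati equation $$\dot P=AP+PA^\top-PC^\top DCP+S$$ with $P(0)$ symmetric positive definite, and let $K=\begin{bmatrix}K_v\\K_g\end{bmatrix}=PC^\top D$. Consider the observer $$\dot{\hat v}=-\omega^\times\hat v+a+z+K_v y,\qquad \dot z=-\omega^\times z+K_g y,\qquad y=-\pi_{\eta_v}\hat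 v ,$$ with error $x=(v^{\mathcal B}-\hat v,\ g^{\mathcal B}-z)\in\mathbb R^6$. Then $(\hat v,z)$ satisfies the observer equations on a time interval if and only if $x$ satisfies $\dot x=(A(t)-K(t)C(t))x$ there, and the equilibrium $x=0$ of this system is globally exponentially stable: there are $c,\alpha>0$ such that every solution $x$ starting at any time $t_0\ge0$ satisfies $|x(t)|\le c\,e^{-\alpha(t-t_0)}|x(t_0)|$ for all $t\ge t_0$ at which it is defined. -/

import Mathlib

open Set Matrix

noncomputable section

namespace Odometry

/-- Column vectors of `ℝ³`. -/
abbrev V3 : Type := Fin 3 → ℝ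

/-- Real `3 × 3` matrices. -/
abbrev M3 : Type := Matrix (Fin 3) (Fin 3) ℝ

/-- Index set of the six-dimensional state `x = (ṽ, z̃)`. -/
abbrev I6 : Type := Fin 3 ⊕ Fin 3

/-- The Euclidean norm `|x| = √(xᵀ x)` of a coordinate vector. -/
def eucNorm {ι : Type*} [Fintype ι] (x : ι → ℝ) : ℝ := ‖WithLp.toLp 2 x‖

/-- The skew-symmetric matrix `u^×`, with `u^× w = u × w`. -/
def skew (u : V3) : M3 :=
  !![0, -u 2, u 1;
     u 2, 0, -u 0;
     -u 1, u 0, 0]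

theorem skew_mulVec (u w : V3) : skew u *ᵥ w = crossProduct u w := by
  ext i
  fin_cases i <;>
    simp [skew, cross_apply, Matrix.mulVec, dotProduct, Fin.sum_univ_three] <;> ring

/-- The orthogonal projection `π_u = I - u uᵀ / |u|²` onto the plane orthogonal to `u ≠ 0`. -/
def proj (u : V3) : M3 := 1 - (1 / eucNorm u ^ 2) • vecMulVec u u

/-- Boundedness, uniformly for all times `t ≥ 0`, of a vector-valued function of time. -/
def BoundedVec (f : ℝ → V3) : Prop := ∃ M : ℝ, ∀ t, 0 ≤ t → eucNorm (f t) ≤ M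

/-- The entrywise integral `∫_a^b F(s) ds` of a matrix-valued function. -/
def matIntegral {m n : Type*} (F : ℝ → Matrix m n ℝ) (a b : ℝ) : Matrix m n ℝ :=
  Matrix.of fun i j => ∫ s in a..b, F s i j

/-- `F` is differentiable at `t` relative to the set of times `I`, with derivative the matrix `F'`
(all entries are differentiable). -/
def HasMatDerivWithinAt {m n : Type*} (F : ℝ → Matrix m n ℝ) (F' : Matrix m n ℝ)
    (I : Set ℝ) (t : ℝ) : Prop :=
  ∀ i j, HasDerivWithinAt (fun s => F s i j) (F' i j) I t

/-! ### Linear time-varying systems -/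

/-- `Φ(s, t)`, `s ≥ t ≥ 0`, is the transition matrix associated with `A`:
`dΦ(s,t)/ds = A(s) Φ(s,t)` and `Φ(t,t) = I`. -/
def IsTransitionMatrix {n : Type*} [Fintype n] [DecidableEq n]
    (A : ℝ → Matrix n n ℝ) (Φ : ℝ → ℝ → Matrix n n ℝ) : Prop :=
  ∀ t, 0 ≤ t → Φ t t = 1 ∧
    ∀ s, t ≤ s → HasMatDerivWithinAt (fun r => Φ r t) (A s * Φ s t) (Ici t) s

/-- The observability Gramian
`W(t, t+δ) = (1/δ) ∫_t^{t+δ} Φ(s,t)ᵀ C(s)ᵀ C(s) Φ(s,t) ds`. -/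
def gramian {n m : Type*} [Fintype n] [Fintype m]
    (Φ : ℝ → ℝ → Matrix n n ℝ) (C : ℝ → Matrix m n ℝ) (δ t : ℝ) : Matrix n n ℝ :=
  (1 / δ) • matIntegral (fun s => (Φ s t)ᵀ * (C s)ᵀ * C s * Φ s t) t (t + δ)

/-- Uniform observability of the pair `(A(t), C(t))`: there are `δ, μ > 0` such that
`W(t, t+δ) ≥ μ I` for all `t ≥ 0`, in the order of symmetric matrices. (For continuous `A` the
transition matrix `Φ(s, t)` is unique on `s ≥ t ≥ 0`, where alone it is used.) -/
def UniformlyObservable {n m : Type*} [Fintype n] [DecidableEq n] [Fintype m]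
    (A : ℝ → Matrix n n ℝ) (C : ℝ → Matrix m n ℝ) : Prop :=
  ∃ Φ : ℝ → ℝ → Matrix n n ℝ, IsTransitionMatrix A Φ ∧
    ∃ δ μ : ℝ, 0 < δ ∧ 0 < μ ∧
      ∀ t, 0 ≤ t → (gramian Φ C δ t - μ • (1 : Matrix n n ℝ)).PosSemidef

/-- `x` solves `ẋ = M(t) x` on the time interval `[t₀, t₁]`. -/
def IsSolutionOn {n : Type*} [Fintype n] (M : ℝ → Matrix n n ℝ) (x : ℝ → n → ℝ)
    (t₀ t₁ : ℝ) : Prop :=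
  ∀ t ∈ Icc t₀ t₁, HasDerivWithinAt x (M t *ᵥ x t) (Icc t₀ t₁) t

/-- Global exponential stability of the equilibrium `x = 0` of `ẋ = M(t) x`, `t ≥ 0`: there are
`c, α > 0` such that every solution, whatever its initial time `t₀ ≥ 0` and its initial value,
satisfies `|x(t)| ≤ c exp(-α (t - t₀)) |x(t₀)|` as long as it is defined. -/
def GloballyExponentiallyStable {n : Type*} [Fintype n] (M : ℝ → Matrix n n ℝ) : Prop :=
  ∃ c α : ℝ, 0 < c ∧ 0 < α ∧ ∀ (t₀ t₁ : ℝ) (x : ℝ → n → ℝ), 0 ≤ t₀ →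
    IsSolutionOn M x t₀ t₁ →
      ∀ t ∈ Icc t₀ t₁, eucNorm (x t) ≤ c * Real.exp (-α * (t - t₀)) * eucNorm (x t₀)

/-! ### The vehicle -/

/-- The gravity vector `g e₃` in the inertial frame. -/
def gravity (g : ℝ) : V3 := ![0, 0, g]

/-- Kinematics of the vehicle for `t ≥ 0`: the attitude `R(t) ∈ SO(3)`, the inertial-frame linear
velocity `v(t)`, the body-frame angular velocity `ω(t)` and the specific acceleration `a(t)` satisfy
`Ṙ = R ω^×` and `v̇ = R a + g e₃`. -/
structure IsVehicle (g : ℝ) (R : ℝ → M3) (v ω a : ℝ → V3) : Prop where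
  rotation : ∀ t, 0 ≤ t → R t ∈ Matrix.specialOrthogonalGroup (Fin 3) ℝ
  attitude : ∀ t, 0 ≤ t → HasMatDerivWithinAt R (R t * skew (ω t)) (Ici 0) t
  velocity : ∀ t, 0 ≤ t → HasDerivWithinAt v (R t *ᵥ a t + gravity g) (Ici 0) t

/-- The velocity in the body frame, `v^B = Rᵀ v`. -/
def bodyVel (R : ℝ → M3) (v : ℝ → V3) (t : ℝ) : V3 := (R t)ᵀ *ᵥ v t

/-- The gravity vector in the body frame, `g^B = Rᵀ g e₃`. -/
def bodyGravity (g : ℝ) (R : ℝ → M3) (t : ℝ) : V3 := (R t)ᵀ *ᵥ gravity g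

/-- The measured velocity direction in the body frame, `η_v = Rᵀ v / |v|`. -/
def bodyDir (R : ℝ → M3) (v : ℝ → V3) (t : ℝ) : V3 :=
  (R t)ᵀ *ᵥ ((1 / eucNorm (v t)) • v t)

/-- The velocity direction in the inertial frame, `η_v^I = R η_v`. -/
def inertialDir (R : ℝ → M3) (v : ℝ → V3) (t : ℝ) : V3 := R t *ᵥ bodyDir R v t

/-- Persistent excitation of a direction `η(t)`: there are `δ, μ > 0` such that
`(1/δ) ∫_t^{t+δ} π_{η(τ)} dτ ≥ μ I₃` for all `t ≥ 0`. -/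
def PersistentlyExciting (η : ℝ → V3) : Prop :=
  ∃ δ μ : ℝ, 0 < δ ∧ 0 < μ ∧ ∀ t, 0 ≤ t →
    ((1 / δ) • matIntegral (fun τ => proj (η τ)) t (t + δ) - μ • (1 : M3)).PosSemidef

/-! ### The observer -/

/-- The state matrix `A(t) = [[-ω^×, I₃], [0, -ω^×]]`. -/
def stateMat (ω : ℝ → V3) (t : ℝ) : Matrix I6 I6 ℝ :=
  Matrix.fromBlocks (-skew (ω t)) 1 0 (-skew (ω t))

/-- The output matrix `C(t) = [π_η, 0]`. -/
def outputMat (η : ℝ → V3) (t : ℝ) : Matrix (Fin 3) I6 ℝ :=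
  Matrix.fromCols (proj (η t)) 0

/-- Admissible weights: continuous, bounded and uniformly positive definite symmetric
matrix-valued functions of `t ≥ 0`. -/
structure IsWeight {n : Type*} [Fintype n] [DecidableEq n] (S : ℝ → Matrix n n ℝ) : Prop where
  continuousOn : ContinuousOn S (Ici 0)
  bounded : ∃ M : ℝ, ∀ t, 0 ≤ t → ∀ i j, |S t i j| ≤ M
  uniformlyPosDef : ∃ ε : ℝ, 0 < ε ∧ ∀ t, 0 ≤ t → (S t - ε • (1 : Matrix n n ℝ)).PosSemidef

/-- `P` solves the continuous Riccati equation `Ṗ = A P + P Aᵀ - P Cᵀ D C P + S` for `t ≥ 0`, with a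
symmetric positive definite initial value. -/
structure IsRiccatiSolution {n m : Type*} [Fintype n] [Fintype m]
    (A : ℝ → Matrix n n ℝ) (C : ℝ → Matrix m n ℝ) (S : ℝ → Matrix n n ℝ)
    (D : ℝ → Matrix m m ℝ) (P : ℝ → Matrix n n ℝ) : Prop where
  initial : (P 0).PosDef
  equation : ∀ t, 0 ≤ t → HasMatDerivWithinAt P
    (A t * P t + P t * (A t)ᵀ - P t * (C t)ᵀ * D t * C t * P t + S t) (Ici 0) t

/-- The observer gain `K = P Cᵀ D`. -/
def gain {n m : Type*} [Fintype n] [Fintype m] (C : ℝ → Matrix m n ℝ)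
    (D : ℝ → Matrix m m ℝ) (P : ℝ → Matrix n n ℝ) (t : ℝ) : Matrix n m ℝ :=
  P t * (C t)ᵀ * D t

/-- `(v̂, z)` is, on the time interval `[t₀, t₁]`, a trajectory of the observer
`dv̂/dt = -ω^× v̂ + a + z + K_v y`, `ż = -ω^× z + K_g y`, where `y = -π_η v̂` and
`K = [K_vᵀ K_gᵀ]ᵀ`. -/
def IsObserverTrajectory (ω a η : ℝ → V3) (K : ℝ → Matrix I6 (Fin 3) ℝ) (vhat z : ℝ → V3)
    (t₀ t₁ : ℝ) : Prop :=
  ∀ t ∈ Icc t₀ t₁,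
    HasDerivWithinAt vhat
      (-(skew (ω t) *ᵥ vhat t) + a t + z t + (K t).toRows₁ *ᵥ (-(proj (η t) *ᵥ vhat t)))
      (Icc t₀ t₁) t ∧
    HasDerivWithinAt z
      (-(skew (ω t) *ᵥ z t) + (K t).toRows₂ *ᵥ (-(proj (η t) *ᵥ vhat t)))
      (Icc t₀ t₁) t

/-- The observer error `x = (v^B - v̂, g^B - z)`. -/
def observerError (g : ℝ) (R : ℝ → M3) (v vhat z : ℝ → V3) (t : ℝ) : I6 → ℝ :=
  Sum.elim (bodyVel R v t - vhat t) (bodyGravity g R t - z t)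

end Odometry

end

/-! In the inertial frame the angular velocity disappears: the error system without output injection
becomes the double integrator, and its output is, up to a rotation, `π (α + (s - t) β)`, the
projection of an affine motion. Observability thus asks for excitation along affine motions, whereas
persistent excitation gives it for constant vectors. Over a long enough window an affine motion is,
at one of its two ends, large compared with its displacement during one excitation period, and there
it can be treated as constant (`affine_excitation`).

Stability is a Lyapunov argument with `V = xᵀ P⁻¹ x`. The Riccati equation gives `V' = -(C x)ᵀ D (C
x) - yᵀ S y` with `y = P⁻¹ x`, and this yields exponential decay once `p I ≤ P ≤ q I` uniformly in
time. The lower bound holds because `S ≥ ε I` pushes a small eigenvalue of `P` upwards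
(`exists_lower_bound`). The upper bound is where observability enters, by duality: along `ṗ = -Aᵀ p
+ Cᵀ u` the terms in `A` drop out of the derivative of `pᵀ P p`, and the term `-(C P p)ᵀ D (C P p)`
absorbs the control term. Steering `p` from `0` to `x` therefore bounds `xᵀ P x` whatever the
earlier value of `P` (`exists_upper_bound`); the Gramian supplies the control
(`AdjointControllable.of_gramian`).

The observer has this error system because `π_η v^B = 0`, so that the innovation is `y = C x`. -/

namespace Odometry

open Filter Topology
open scoped Matrix.Norms.L2Operator

/-! ### Euclidean and operator norm estimates -/

section LinearAlgebra

variable {m n l : Type*} [Fintype m] [Fintype n] [Fintype l]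

theorem eucNorm_nonneg (x : n → ℝ) : 0 ≤ eucNorm x := norm_nonneg _

theorem eucNorm_sq (x : n → ℝ) : eucNorm x ^ 2 = x ⬝ᵥ x := by
  rw [eucNorm, EuclideanSpace.real_norm_sq_eq]
  simp [dotProduct, sq]

theorem dotProduct_self_nonneg_real (x : n → ℝ) : 0 ≤ x ⬝ᵥ x := by
  rw [← eucNorm_sq]; positivity

theorem dotProduct_self_pos {x : n → ℝ} (hx : x ≠ 0) : 0 < x ⬝ᵥ x :=
  lt_of_le_of_ne (dotProduct_self_nonneg_real x) fun h => hx (dotProduct_self_eq_zero.1 h.symm)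

theorem abs_dotProduct_le (x y : n → ℝ) : |x ⬝ᵥ y| ≤ eucNorm x * eucNorm y := by
  have h := abs_real_inner_le_norm (WithLp.toLp 2 y) (WithLp.toLp 2 x)
  rw [EuclideanSpace.inner_toLp_toLp] at h
  simpa [eucNorm, mul_comm] using h

theorem eucNorm_mulVec_le [DecidableEq n] (A : Matrix m n ℝ) (x : n → ℝ) :
    eucNorm (A *ᵥ x) ≤ ‖A‖ * eucNorm x :=
  Matrix.l2_opNorm_mulVec A (WithLp.toLp 2 x)

theorem dotProduct_self_mulVec_le [DecidableEq n] (A : Matrix m n ℝ) (x : n → ℝ) :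
    (A *ᵥ x) ⬝ᵥ (A *ᵥ x) ≤ ‖A‖ ^ 2 * (x ⬝ᵥ x) := by
  rw [← eucNorm_sq, ← eucNorm_sq, ← mul_pow]
  exact pow_le_pow_left₀ (eucNorm_nonneg _) (eucNorm_mulVec_le A x) 2

theorem abs_dotProduct_mulVec_le [DecidableEq n] (A : Matrix m n ℝ) (x : m → ℝ) (y : n → ℝ) :
    |x ⬝ᵥ A *ᵥ y| ≤ ‖A‖ * (eucNorm x * eucNorm y) := by
  refine (abs_dotProduct_le _ _).trans ?_
  rw [mul_left_comm]
  exact mul_le_mul_of_nonneg_left (eucNorm_mulVec_le A y) (eucNorm_nonneg _)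

theorem abs_quadForm_le [DecidableEq n] (A : Matrix n n ℝ) (x : n → ℝ) :
    |x ⬝ᵥ A *ᵥ x| ≤ ‖A‖ * (x ⬝ᵥ x) := by
  rw [← eucNorm_sq, sq]
  exact abs_dotProduct_mulVec_le A x x

theorem norm_transpose [DecidableEq m] [DecidableEq n] (A : Matrix m n ℝ) : ‖Aᵀ‖ = ‖A‖ := by
  rw [← Matrix.l2_opNorm_conjTranspose A, conjTranspose_eq_transpose_of_trivial]

/-- Expansion in matrix units gives a constant that depends on the index types only, so entrywise
bounds uniform in time become operator norm bounds uniform in time. -/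
theorem norm_le_of_entry_le [DecidableEq n] :
    ∃ K : ℝ, 0 ≤ K ∧ ∀ (A : Matrix m n ℝ) (B : ℝ), (∀ i j, |A i j| ≤ B) → ‖A‖ ≤ B * K := by
  classical
  refine ⟨∑ i : m, ∑ j : n, ‖Matrix.single i j (1 : ℝ)‖,
    Finset.sum_nonneg fun _ _ => Finset.sum_nonneg fun _ _ => norm_nonneg _, fun A B h => ?_⟩
  conv_lhs => rw [matrix_eq_sum_single A]
  rw [Finset.mul_sum]
  refine (norm_sum_le _ _).trans (Finset.sum_le_sum fun i _ => ?_)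
  rw [Finset.mul_sum]
  refine (norm_sum_le _ _).trans (Finset.sum_le_sum fun j _ => ?_)
  have : Matrix.single i j (A i j) = A i j • Matrix.single i j (1 : ℝ) := by
    rw [smul_single, smul_eq_mul, mul_one]
  rw [this, norm_smul]
  exact mul_le_mul_of_nonneg_right (h i j) (norm_nonneg _)

theorem posSemidef_sub_smul_one_iff [DecidableEq n] (A : Matrix n n ℝ) (c : ℝ) :
    (A - c • (1 : Matrix n n ℝ)).PosSemidef ↔
      Aᵀ = A ∧ ∀ x : n → ℝ, c * (x ⬝ᵥ x) ≤ x ⬝ᵥ A *ᵥ x := by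
  rw [posSemidef_iff_dotProduct_mulVec]
  refine and_congr ?_ (forall_congr' fun x => ?_)
  · rw [IsHermitian, conjTranspose_eq_transpose_of_trivial, transpose_sub, transpose_smul,
      transpose_one, sub_left_inj]
  · rw [star_trivial, sub_mulVec, smul_mulVec, one_mulVec, dotProduct_sub, dotProduct_smul,
      smul_eq_mul, sub_nonneg]

theorem eucNorm_le_sqrt_mul {x y : n → ℝ} {c : ℝ} (hc : 0 ≤ c) (h : x ⬝ᵥ x ≤ c * (y ⬝ᵥ y)) :
    eucNorm x ≤ √c * eucNorm y := by
  refine le_of_sq_le_sq ?_ (mul_nonneg (Real.sqrt_nonneg _) (eucNorm_nonneg _))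
  rwa [mul_pow, Real.sq_sqrt hc, eucNorm_sq, eucNorm_sq]

theorem transpose_quadForm (A : Matrix m n ℝ) (x : m → ℝ) (y : n → ℝ) :
    y ⬝ᵥ Aᵀ *ᵥ x = x ⬝ᵥ A *ᵥ y := by
  rw [mulVec_transpose, dotProduct_comm, dotProduct_mulVec]

end LinearAlgebra

/-! ### Derivatives and integrals of matrix-valued functions -/

section Calculus

variable {m n l : Type*} [Fintype m] [Fintype n] [Fintype l]
variable {s : Set ℝ} {t : ℝ}

theorem hasMatDerivWithinAt_iff {m n : Type*} [Finite m] [Fintype n]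
    {F : ℝ → Matrix m n ℝ} {F' : Matrix m n ℝ} :
    HasMatDerivWithinAt F F' s t ↔ HasDerivWithinAt F F' s t := by
  have := Fintype.ofFinite m
  exact ((hasDerivWithinAt_pi (φ := F)).trans (forall_congr' fun _ => hasDerivWithinAt_pi)).symm

theorem hasDerivWithinAt_matrix {F : ℝ → Matrix m n ℝ} {F' : Matrix m n ℝ} :
    HasDerivWithinAt F F' s t ↔ ∀ i j, HasDerivWithinAt (fun r => F r i j) (F' i j) s t :=
  hasMatDerivWithinAt_iff.symm

theorem HasDerivWithinAt.matrixMul {F : ℝ → Matrix m n ℝ} {G : ℝ → Matrix n l ℝ}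
    {F' : Matrix m n ℝ} {G' : Matrix n l ℝ} (hF : HasDerivWithinAt F F' s t)
    (hG : HasDerivWithinAt G G' s t) :
    HasDerivWithinAt (fun r => F r * G r) (F' * G t + F t * G') s t := by
  rw [hasDerivWithinAt_matrix] at *
  intro i j
  simp only [mul_apply, Matrix.add_apply, ← Finset.sum_add_distrib]
  exact HasDerivWithinAt.fun_sum fun k _ => (hF i k).fun_mul (hG k j)

theorem HasDerivWithinAt.matrixMulVec {F : ℝ → Matrix m n ℝ} {x : ℝ → n → ℝ}
    {F' : Matrix m n ℝ} {x' : n → ℝ} (hF : HasDerivWithinAt F F' s t)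
    (hx : HasDerivWithinAt x x' s t) :
    HasDerivWithinAt (fun r => F r *ᵥ x r) (F' *ᵥ x t + F t *ᵥ x') s t := by
  rw [hasDerivWithinAt_matrix] at hF
  rw [hasDerivWithinAt_pi] at hx ⊢
  intro i
  simp only [mulVec, dotProduct, Pi.add_apply, ← Finset.sum_add_distrib]
  exact HasDerivWithinAt.fun_sum fun k _ => (hF i k).fun_mul (hx k)

theorem HasDerivWithinAt.dotProd {x y : ℝ → n → ℝ} {x' y' : n → ℝ}
    (hx : HasDerivWithinAt x x' s t) (hy : HasDerivWithinAt y y' s t) :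
    HasDerivWithinAt (fun r => x r ⬝ᵥ y r) (x' ⬝ᵥ y t + x t ⬝ᵥ y') s t := by
  rw [hasDerivWithinAt_pi] at hx hy
  simp only [dotProduct, ← Finset.sum_add_distrib]
  exact HasDerivWithinAt.fun_sum fun k _ => (hx k).fun_mul (hy k)

theorem HasDerivWithinAt.matrixTranspose {F : ℝ → Matrix m n ℝ} {F' : Matrix m n ℝ}
    (hF : HasDerivWithinAt F F' s t) : HasDerivWithinAt (fun r => (F r)ᵀ) F'ᵀ s t := by
  rw [hasDerivWithinAt_matrix] at *
  exact fun i j => hF j i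

theorem HasDerivWithinAt.quadForm {P : ℝ → Matrix n n ℝ} {x : ℝ → n → ℝ}
    {P' : Matrix n n ℝ} {x' : n → ℝ} (hP : HasDerivWithinAt P P' s t)
    (hx : HasDerivWithinAt x x' s t) :
    HasDerivWithinAt (fun r => x r ⬝ᵥ P r *ᵥ x r)
      (x' ⬝ᵥ P t *ᵥ x t + x t ⬝ᵥ (P' *ᵥ x t + P t *ᵥ x')) s t :=
  HasDerivWithinAt.dotProd hx (HasDerivWithinAt.matrixMulVec hP hx)

theorem HasDerivWithinAt.matrixInv [DecidableEq n] {P : ℝ → Matrix n n ℝ} {P' : Matrix n n ℝ}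
    (hP : HasDerivWithinAt P P' s t) (hu : IsUnit (P t)) :
    HasDerivWithinAt (fun r => (P r)⁻¹) (-((P t)⁻¹ * P' * (P t)⁻¹)) s t := by
  obtain ⟨u, hu⟩ := hu
  have h := hasFDerivAt_ringInverse (𝕜 := ℝ) u
  rw [hu] at h
  have h2 := h.comp_hasDerivWithinAt t hP
  have e : ((u⁻¹ : (Matrix n n ℝ)ˣ) : Matrix n n ℝ) = (P t)⁻¹ := by
    rw [coe_units_inv, hu]
  rw [_root_.neg_apply, ContinuousLinearMap.mulLeftRight_apply, e] at h2
  have e2 : (fun r => (P r)⁻¹) = Ring.inverse ∘ P :=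
    funext fun r => nonsing_inv_eq_ringInverse (P r)
  rw [e2]
  exact h2

theorem continuousOn_entry {m n : Type*} {F : ℝ → Matrix m n ℝ}
    (hF : ContinuousOn F s) (i : m) (j : n) :
    ContinuousOn (fun r => F r i j) s :=
  continuousOn_pi.1 (continuousOn_pi.1 hF i) j

theorem quadForm_matIntegral {F : ℝ → Matrix m n ℝ} {a b : ℝ} (hab : a ≤ b)
    (hF : ContinuousOn F (Icc a b)) (x : m → ℝ) (y : n → ℝ) :
    x ⬝ᵥ matIntegral F a b *ᵥ y = ∫ r in a..b, x ⬝ᵥ F r *ᵥ y := by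
  have hi : ∀ i j, IntervalIntegrable (fun r => F r i j) MeasureTheory.volume a b := fun i j =>
    (continuousOn_entry hF i j).intervalIntegrable_of_Icc hab
  simp only [dotProduct, mulVec, matIntegral, of_apply, Finset.mul_sum]
  rw [intervalIntegral.integral_finsetSum]
  · refine Finset.sum_congr rfl fun i _ => ?_
    rw [intervalIntegral.integral_finsetSum]
    · refine Finset.sum_congr rfl fun j _ => ?_
      rw [intervalIntegral.integral_const_mul, intervalIntegral.integral_mul_const]
    · exact fun j _ => ((hi i j).mul_const _).const_mul _
  · intro i _
    simpa only [Finset.sum_fn] using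
      IntervalIntegrable.sum Finset.univ fun j _ => ((hi i j).mul_const (y j)).const_mul (x i)

theorem hasDerivWithinAt_matIntegral {F : ℝ → Matrix m n ℝ} {a b : ℝ}
    (hF : ContinuousOn F (Icc a b)) (ht : t ∈ Icc a b) :
    HasDerivWithinAt (fun r => matIntegral F a r) (F t) (Icc a b) t := by
  rw [hasDerivWithinAt_matrix]
  intro i j
  have hc := continuousOn_entry hF i j
  have : Fact (t ∈ Icc a b) := ⟨ht⟩
  refine intervalIntegral.integral_hasDerivWithinAt_right ?_ ?_ (hc t ht)
  · exact (hc.mono (Icc_subset_Icc_right ht.2)).intervalIntegrable_of_Icc ht.1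
  · exact hc.stronglyMeasurableAtFilter_nhdsWithin measurableSet_Icc t

theorem matIntegral_transpose {m n : Type*} (F : ℝ → Matrix m n ℝ) (a b : ℝ) :
    (matIntegral F a b)ᵀ = matIntegral (fun r => (F r)ᵀ) a b := rfl

end Calculus

/-! ### Quadratic forms and their lower bounds -/

section QuadForm

variable {n : Type*} [Fintype n]

theorem quadForm_smul (A : Matrix n n ℝ) (c : ℝ) (x : n → ℝ) :
    (c • x) ⬝ᵥ A *ᵥ (c • x) = c ^ 2 * (x ⬝ᵥ A *ᵥ x) := by
  rw [mulVec_smul, dotProduct_smul, smul_dotProduct, smul_eq_mul, smul_eq_mul]; ring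

/-- The norm of `n → ℝ` is the sup norm. Its unit sphere serves as well as the Euclidean one: it is
compact, misses the origin and meets every ray. -/
theorem exists_smul_mem_sphere {x : n → ℝ} (hx : x ≠ 0) :
    ∃ c : ℝ, 0 < c ∧ c • x ∈ Metric.sphere (0 : n → ℝ) 1 := by
  have h : 0 < ‖x‖ := norm_pos_iff.2 hx
  refine ⟨‖x‖⁻¹, by positivity, ?_⟩
  rw [mem_sphere_zero_iff_norm, norm_smul, norm_inv, norm_norm, inv_mul_cancel₀ h.ne']

theorem quadForm_nonneg_of_sphere {A : Matrix n n ℝ}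
    (h : ∀ z ∈ Metric.sphere (0 : n → ℝ) 1, 0 ≤ z ⬝ᵥ A *ᵥ z) (x : n → ℝ) :
    0 ≤ x ⬝ᵥ A *ᵥ x := by
  rcases eq_or_ne x 0 with rfl | hx
  · simp
  obtain ⟨c, hc, hcx⟩ := exists_smul_mem_sphere hx
  have := h _ hcx
  rw [quadForm_smul] at this
  exact nonneg_of_mul_nonneg_right this (by positivity)

theorem ne_zero_of_mem_sphere {z : n → ℝ} (hz : z ∈ Metric.sphere (0 : n → ℝ) 1) : z ≠ 0 := by
  rintro rfl
  simp at hz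

theorem quadForm_sub_smul_one [DecidableEq n] (A : Matrix n n ℝ) (c : ℝ) (x : n → ℝ) :
    x ⬝ᵥ (A - c • (1 : Matrix n n ℝ)) *ᵥ x = x ⬝ᵥ A *ᵥ x - c * (x ⬝ᵥ x) := by
  rw [sub_mulVec, smul_mulVec, one_mulVec, dotProduct_sub, dotProduct_smul, smul_eq_mul]

theorem PosDef.exists_lower_bound [DecidableEq n] {A : Matrix n n ℝ} (hA : A.PosDef) :
    ∃ c : ℝ, 0 < c ∧ ∀ x : n → ℝ, c * (x ⬝ᵥ x) ≤ x ⬝ᵥ A *ᵥ x := by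
  have hq : Continuous fun x : n → ℝ => x ⬝ᵥ A *ᵥ x :=
    continuous_id.dotProduct (continuous_const.matrix_mulVec continuous_id)
  have hd : Continuous fun x : n → ℝ => x ⬝ᵥ x := continuous_id.dotProduct continuous_id
  have hpos : ∀ z ∈ Metric.sphere (0 : n → ℝ) 1, 0 < z ⬝ᵥ A *ᵥ z := fun z hz => by
    simpa using hA.dotProduct_mulVec_pos (ne_zero_of_mem_sphere hz)
  have hK := isCompact_sphere (0 : n → ℝ) 1
  obtain ⟨c, hc, hcle⟩ : ∃ c : ℝ, 0 < c ∧
      ∀ z ∈ Metric.sphere (0 : n → ℝ) 1, c * (z ⬝ᵥ z) ≤ z ⬝ᵥ A *ᵥ z := by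
    -- The sphere is empty when `n` is, and then there are no extrema to take.
    rcases (Metric.sphere (0 : n → ℝ) 1).eq_empty_or_nonempty with he | hne
    · exact ⟨1, one_pos, fun z hz => by simp [he] at hz⟩
    obtain ⟨z₀, hz₀, hmin⟩ := hK.exists_isMinOn hne hq.continuousOn
    obtain ⟨z₁, hz₁, hmax⟩ := hK.exists_isMaxOn hne hd.continuousOn
    have h1 : 0 < z₁ ⬝ᵥ z₁ := dotProduct_self_pos (ne_zero_of_mem_sphere hz₁)
    refine ⟨(z₀ ⬝ᵥ A *ᵥ z₀) / (z₁ ⬝ᵥ z₁), div_pos (hpos _ hz₀) h1, fun z hz => ?_⟩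
    calc _ ≤ (z₀ ⬝ᵥ A *ᵥ z₀) / (z₁ ⬝ᵥ z₁) * (z₁ ⬝ᵥ z₁) :=
          mul_le_mul_of_nonneg_left (hmax hz) (div_pos (hpos _ hz₀) h1).le
      _ = z₀ ⬝ᵥ A *ᵥ z₀ := div_mul_cancel₀ _ h1.ne'
      _ ≤ _ := hmin hz
  refine ⟨c, hc, fun x => ?_⟩
  have := quadForm_nonneg_of_sphere (A := A - c • (1 : Matrix n n ℝ))
    (fun z hz => by rw [quadForm_sub_smul_one]; linarith [hcle z hz]) x
  rw [quadForm_sub_smul_one] at this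
  linarith

theorem PosDef.of_lower_bound {A : Matrix n n ℝ} (hA : Aᵀ = A) {c : ℝ} (hc : 0 < c)
    (h : ∀ x : n → ℝ, c * (x ⬝ᵥ x) ≤ x ⬝ᵥ A *ᵥ x) : A.PosDef := by
  rw [posDef_iff_dotProduct_mulVec]
  refine ⟨by rw [IsHermitian, conjTranspose_eq_transpose_of_trivial, hA], fun x hx => ?_⟩
  rw [star_trivial]
  exact (mul_pos hc (dotProduct_self_pos hx)).trans_le (h x)

theorem symm_dotProduct {A : Matrix n n ℝ} (hA : Aᵀ = A) (x y : n → ℝ) :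
    x ⬝ᵥ A *ᵥ y = y ⬝ᵥ A *ᵥ x := by
  conv_lhs => rw [← transpose_quadForm, hA]

theorem nonpos_of_hasDerivAt_of_left_ge {f : ℝ → ℝ} {f' t a : ℝ} (hf : HasDerivAt f f' t)
    (ha : a < t) (h : ∀ r ∈ Ico a t, f t ≤ f r) : f' ≤ 0 := by
  have hs := (hasDerivWithinAt_iff_tendsto_slope' (s := Iio t) (by simp)).1
    (hf.hasDerivWithinAt (s := Iio t))
  refine le_of_tendsto hs ?_
  filter_upwards [Ioo_mem_nhdsLT ha] with r hr
  rw [slope_def_field]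
  exact div_nonpos_of_nonneg_of_nonpos (sub_nonneg.2 (h r ⟨hr.1.le, hr.2⟩)) (by linarith [hr.2])

end QuadForm

/-! ### Riccati equation: symmetry and uniform lower bound -/

section Riccati

variable {n m : Type*} [Fintype n] [Fintype m]
  {A : ℝ → Matrix n n ℝ} {C : ℝ → Matrix m n ℝ} {S : ℝ → Matrix n n ℝ}
  {D : ℝ → Matrix m m ℝ} {P : ℝ → Matrix n n ℝ}

theorem IsRiccatiSolution.hasDerivWithinAt (hP : IsRiccatiSolution A C S D P) {t : ℝ}
    (ht : 0 ≤ t) : HasDerivWithinAt P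
      (A t * P t + P t * (A t)ᵀ - P t * (C t)ᵀ * D t * C t * P t + S t) (Ici 0) t :=
  hasMatDerivWithinAt_iff.1 (hP.equation t ht)

/-- The right-hand side of the Riccati equation as a quadratic form, in terms of `P y`. -/
theorem quadForm_riccati {A P S : Matrix n n ℝ} {C : Matrix m n ℝ} {D : Matrix m m ℝ}
    (hP : Pᵀ = P) (y : n → ℝ) :
    y ⬝ᵥ (A * P + P * Aᵀ - P * Cᵀ * D * C * P + S) *ᵥ y =
      2 * (y ⬝ᵥ A *ᵥ (P *ᵥ y)) - (C *ᵥ (P *ᵥ y)) ⬝ᵥ D *ᵥ (C *ᵥ (P *ᵥ y)) + y ⬝ᵥ S *ᵥ y := by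
  simp only [add_mulVec, sub_mulVec, dotProduct_add, dotProduct_sub, ← mulVec_mulVec]
  rw [symm_dotProduct hP y (Aᵀ *ᵥ y), symm_dotProduct hP y (Cᵀ *ᵥ _),
    dotProduct_comm (Aᵀ *ᵥ y), transpose_quadForm, dotProduct_comm (Cᵀ *ᵥ _),
    transpose_quadForm, dotProduct_comm (D *ᵥ _)]
  ring

variable [DecidableEq n]

theorem IsRiccatiSolution.continuousOn (hP : IsRiccatiSolution A C S D P) :
    ContinuousOn P (Ici 0) :=
  fun _ ht => (hP.hasDerivWithinAt ht).continuousWithinAt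

/-- Boundedness, uniformly for all times `t ≥ 0`, of a matrix-valued function of time. -/
def BoundedMat {m n : Type*} [Fintype m] [Fintype n] [DecidableEq n]
    (F : ℝ → Matrix m n ℝ) : Prop :=
  ∃ B : ℝ, 0 ≤ B ∧ ∀ t, 0 ≤ t → ‖F t‖ ≤ B

theorem BoundedMat.of_entries {F : ℝ → Matrix m n ℝ}
    (h : ∃ M : ℝ, ∀ t, 0 ≤ t → ∀ i j, |F t i j| ≤ M) : BoundedMat F := by
  obtain ⟨M, hM⟩ := h
  obtain ⟨K, -, hK⟩ := norm_le_of_entry_le (m := m) (n := n)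
  have := fun t ht => hK (F t) M (hM t ht)
  exact ⟨M * K, (norm_nonneg _).trans (this 0 le_rfl), this⟩

theorem IsWeight.boundedMat (hS : IsWeight S) : BoundedMat S := BoundedMat.of_entries hS.bounded

theorem IsWeight.symm (hS : IsWeight S) {t : ℝ} (ht : 0 ≤ t) : (S t)ᵀ = S t := by
  obtain ⟨ε, -, h⟩ := hS.uniformlyPosDef
  exact ((posSemidef_sub_smul_one_iff _ _).1 (h t ht)).1

theorem IsWeight.lower_bound (hS : IsWeight S) : ∃ ε : ℝ, 0 < ε ∧ ∀ t, 0 ≤ t →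
    ∀ x : n → ℝ, ε * (x ⬝ᵥ x) ≤ x ⬝ᵥ S t *ᵥ x := by
  obtain ⟨ε, hε, h⟩ := hS.uniformlyPosDef
  exact ⟨ε, hε, fun t ht => ((posSemidef_sub_smul_one_iff _ _).1 (h t ht)).2⟩

variable [DecidableEq m]

theorem BoundedMat.outputWeight (hC : BoundedMat C) (hD : BoundedMat D) :
    BoundedMat fun t => (C t)ᵀ * D t * C t := by
  obtain ⟨c, hc, hC⟩ := hC
  obtain ⟨d, hd, hD⟩ := hD
  refine ⟨c * d * c, by positivity, fun t ht => ?_⟩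
  refine (l2_opNorm_mul _ _).trans ?_
  refine mul_le_mul ((l2_opNorm_mul _ _).trans ?_) (hC t ht) (norm_nonneg _) (by positivity)
  rw [norm_transpose]
  exact mul_le_mul (hC t ht) (hD t ht) (norm_nonneg _) hc

/-- Since `S` and `D` are symmetric, `P - Pᵀ` solves a homogeneous linear equation whose
coefficients are bounded on compact intervals. It vanishes at time `0`, hence always, by Grönwall.
-/
theorem IsRiccatiSolution.symm (hA : BoundedMat A) (hC : BoundedMat C) (hS : IsWeight S)
    (hD : IsWeight D) (hP : IsRiccatiSolution A C S D P) {t : ℝ} (ht : 0 ≤ t) :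
    (P t)ᵀ = P t := by
  obtain ⟨a, ha, hA⟩ := hA
  obtain ⟨q, hq, hQ⟩ := hC.outputWeight hD.boundedMat
  obtain ⟨B, hB⟩ := isCompact_Icc.exists_bound_of_continuousOn
    (hP.continuousOn.mono (Icc_subset_Ici_self : Icc 0 t ⊆ Ici 0))
  have hB0 : 0 ≤ B := (norm_nonneg _).trans (hB 0 ⟨le_rfl, ht⟩)
  have hder : ∀ r, 0 ≤ r → HasDerivWithinAt (fun r => P r - (P r)ᵀ) _ (Ici 0) r := fun r hr =>
    (hP.hasDerivWithinAt hr).sub (HasDerivWithinAt.matrixTranspose (hP.hasDerivWithinAt hr))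
  have key := norm_le_gronwallBound_of_norm_deriv_right_le (δ := 0) (ε := 0)
    (K := a + a + (q * B + B * q)) (a := 0) (b := t)
    (fun r hr => (hder r hr.1).continuousWithinAt.mono Icc_subset_Ici_self)
    (fun r hr => (hder r hr.1).mono (Ici_subset_Ici.2 hr.1)) ?_ ?_ t ⟨ht, le_rfl⟩
  · rw [gronwallBound_ε0_δ0, norm_le_zero_iff, sub_eq_zero] at key
    exact key.symm
  · have h0 := hP.initial.isHermitian
    rw [IsHermitian, conjTranspose_eq_transpose_of_trivial] at h0
    rw [h0, sub_self, norm_zero]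
  · intro r hr
    -- With `Q = Cᵀ D C`, the quadratic term splits as `P Q P - Pᵀ Q Pᵀ = (P - Pᵀ) Q P + Pᵀ Q (P -
    -- Pᵀ)`.
    have e : A r * P r + P r * (A r)ᵀ - P r * (C r)ᵀ * D r * C r * P r + S r -
        (A r * P r + P r * (A r)ᵀ - P r * (C r)ᵀ * D r * C r * P r + S r)ᵀ =
        A r * (P r - (P r)ᵀ) + (P r - (P r)ᵀ) * (A r)ᵀ -
          ((P r - (P r)ᵀ) * ((C r)ᵀ * D r * C r * P r) +
            (P r)ᵀ * ((C r)ᵀ * D r * C r) * (P r - (P r)ᵀ)) := by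
      simp only [transpose_add, transpose_sub, transpose_mul, transpose_transpose,
        hS.symm hr.1, hD.symm hr.1, mul_sub, sub_mul, Matrix.mul_assoc]
      abel
    rw [e, add_zero]
    set E := P r - (P r)ᵀ
    have hPB := hB r ⟨hr.1, hr.2.le⟩
    have h1 : ‖A r * E‖ ≤ a * ‖E‖ :=
      (l2_opNorm_mul _ _).trans (mul_le_mul_of_nonneg_right (hA r hr.1) (norm_nonneg _))
    have h2 : ‖E * (A r)ᵀ‖ ≤ ‖E‖ * a := by
      refine (l2_opNorm_mul _ _).trans (mul_le_mul_of_nonneg_left ?_ (norm_nonneg _))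
      rw [norm_transpose]; exact hA r hr.1
    have h3 : ‖E * ((C r)ᵀ * D r * C r * P r)‖ ≤ ‖E‖ * (q * B) := by
      refine (l2_opNorm_mul _ _).trans (mul_le_mul_of_nonneg_left ?_ (norm_nonneg _))
      exact (l2_opNorm_mul _ _).trans (mul_le_mul (hQ r hr.1) hPB (norm_nonneg _) hq)
    have h4 : ‖(P r)ᵀ * ((C r)ᵀ * D r * C r) * E‖ ≤ B * q * ‖E‖ := by
      refine (l2_opNorm_mul _ _).trans (mul_le_mul_of_nonneg_right ?_ (norm_nonneg _))
      refine (l2_opNorm_mul _ _).trans ?_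
      rw [norm_transpose]
      exact mul_le_mul hPB (hQ r hr.1) (norm_nonneg _) hB0
    have h5 := norm_sub_le (A r * E + E * (A r)ᵀ)
      (E * ((C r)ᵀ * D r * C r * P r) + (P r)ᵀ * ((C r)ᵀ * D r * C r) * E)
    have h6 := norm_add_le (A r * E) (E * (A r)ᵀ)
    have h7 := norm_add_le (E * ((C r)ᵀ * D r * C r * P r))
      ((P r)ᵀ * ((C r)ᵀ * D r * C r) * E)
    linarith

/-- First-contact argument: if `P - p I` ceased to be positive definite, then at the first such time
`P y = p y` for some `y ≠ 0`, and for small `p` the term `S` makes `yᵀ P y` strictly increasing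
there, although it has just come down to its value. -/
theorem IsRiccatiSolution.exists_lower_bound (hA : BoundedMat A) (hC : BoundedMat C)
    (hS : IsWeight S) (hD : IsWeight D) (hP : IsRiccatiSolution A C S D P) :
    ∃ p : ℝ, 0 < p ∧ ∀ t, 0 ≤ t → ∀ x : n → ℝ, p * (x ⬝ᵥ x) ≤ x ⬝ᵥ P t *ᵥ x := by
  have hsymm : ∀ t, 0 ≤ t → (P t)ᵀ = P t := fun t ht => hP.symm hA hC hS hD ht
  obtain ⟨q, hq, hQ⟩ := hC.outputWeight hD.boundedMat
  obtain ⟨a, ha, hA⟩ := hA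
  obtain ⟨ε, hε, hSε⟩ := hS.lower_bound
  obtain ⟨c, hc, hP0⟩ := PosDef.exists_lower_bound hP.initial
  -- `p < c` keeps contact from occurring at time `0`; the last inequality makes the derivative at
  -- contact positive. The bound `p ≤ 1` in the witness reduces `p ^ 2 * q` to `p * q`.
  obtain ⟨p, hp, hpc, hpε⟩ : ∃ p : ℝ, 0 < p ∧ p < c ∧ 2 * p * a + p ^ 2 * q < ε := by
    have hd : 0 < 2 * (2 * a + q + 1) := by positivity
    refine ⟨min (c / 2) (min 1 (ε / (2 * (2 * a + q + 1)))), by positivity,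
      (min_le_left _ _).trans_lt (by linarith), ?_⟩
    set p := min (c / 2) (min 1 (ε / (2 * (2 * a + q + 1))))
    have hp : 0 < p := by positivity
    have h1 : p ≤ 1 := (min_le_right _ _).trans (min_le_left _ _)
    have h2 : p * (2 * (2 * a + q + 1)) ≤ ε :=
      (le_div_iff₀ hd).1 ((min_le_right _ _).trans (min_le_right _ _))
    have h3 : p ^ 2 * q ≤ p * q := by
      refine mul_le_mul_of_nonneg_right ?_ hq
      rw [sq]; exact mul_le_of_le_one_left hp.le h1
    nlinarith
  refine ⟨p, hp, ?_⟩
  let N : ℝ → Matrix n n ℝ := fun t => P t - p • (1 : Matrix n n ℝ)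
  have hNq : ∀ t x, x ⬝ᵥ N t *ᵥ x = x ⬝ᵥ P t *ᵥ x - p * (x ⬝ᵥ x) := fun t x =>
    quadForm_sub_smul_one _ _ _
  suffices h : ∀ T, 0 ≤ T → ∀ x, 0 ≤ x ⬝ᵥ N T *ᵥ x from fun t ht x => by
    linarith [h t ht x, hNq t x]
  intro T hT x
  refine quadForm_nonneg_of_sphere (fun z hz => ?_) x
  by_contra! hneg
  have hNc : ContinuousOn N (Ici 0) := hP.continuousOn.sub continuousOn_const
  let f : ℝ × (n → ℝ) → ℝ := fun w => w.2 ⬝ᵥ N w.1 *ᵥ w.2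
  have hK : IsCompact (Icc 0 T ×ˢ Metric.sphere (0 : n → ℝ) 1) :=
    isCompact_Icc.prod (isCompact_sphere _ _)
  have hf : ContinuousOn f (Icc 0 T ×ˢ Metric.sphere (0 : n → ℝ) 1) := by
    have h1 : ContinuousOn (fun w : ℝ × (n → ℝ) => N w.1)
        (Icc 0 T ×ˢ Metric.sphere (0 : n → ℝ) 1) :=
      hNc.comp continuousOn_fst fun w hw => hw.1.1
    rw [continuousOn_iff_continuous_domRestrict] at h1 ⊢
    have h2 : Continuous fun w : (Icc 0 T ×ˢ Metric.sphere (0 : n → ℝ) 1 : Set (ℝ × (n → ℝ))) =>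
        w.1.2 := continuous_snd.comp continuous_subtype_val
    exact h2.dotProduct (h1.matrix_mulVec h2)
  -- The pairs (time, direction) at which positivity fails form a compact set, so there is one of
  -- least time.
  have hZ : IsCompact ((Icc 0 T ×ˢ Metric.sphere (0 : n → ℝ) 1) ∩ f ⁻¹' Iic 0) :=
    hK.of_isClosed_subset (hf.preimage_isClosed_of_isClosed hK.isClosed isClosed_Iic)
      inter_subset_left
  obtain ⟨⟨t, y⟩, ⟨⟨⟨ht0, htT⟩, hy⟩, hfy⟩, hmin⟩ :=
    hZ.exists_isMinOn ⟨(T, z), ⟨⟨hT, le_rfl⟩, hz⟩, hneg.le⟩ continuousOn_fst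
  have hpos : ∀ r ∈ Ico 0 t, ∀ w ∈ Metric.sphere (0 : n → ℝ) 1, 0 < w ⬝ᵥ N r *ᵥ w := by
    intro r hr w hw
    by_contra! hle
    have := hmin (a := (r, w)) ⟨⟨⟨hr.1, hr.2.le.trans htT⟩, hw⟩, hle⟩
    exact absurd this (not_le.2 hr.2)
  have hy0 : 0 < y ⬝ᵥ y := dotProduct_self_pos (ne_zero_of_mem_sphere hy)
  have hfy' : y ⬝ᵥ N t *ᵥ y ≤ 0 := hfy
  have ht : 0 < t := by
    refine lt_of_le_of_ne ht0 fun h => ?_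
    subst h
    have := hNq 0 y
    have := hP0 y
    nlinarith
  have hquad : ∀ w : n → ℝ, HasDerivAt (fun r => w ⬝ᵥ N r *ᵥ w)
      (w ⬝ᵥ (A t * P t + P t * (A t)ᵀ - P t * (C t)ᵀ * D t * C t * P t + S t) *ᵥ w) t := by
    intro w
    have h1 := ((hP.hasDerivWithinAt ht0).sub_const (p • (1 : Matrix n n ℝ)))
    have h2 := HasDerivWithinAt.quadForm h1 (hasDerivWithinAt_const t (Ici 0) w)
    simp only [zero_dotProduct, mulVec_zero, add_zero, zero_add] at h2
    exact h2.hasDerivAt (Ici_mem_nhds ht)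
  have hnn : ∀ w : n → ℝ, 0 ≤ w ⬝ᵥ N t *ᵥ w := by
    refine fun w => quadForm_nonneg_of_sphere (fun w hw => ?_) w
    have hl : Tendsto (fun r => w ⬝ᵥ N r *ᵥ w) (𝓝[<] t) (𝓝 (w ⬝ᵥ N t *ᵥ w)) :=
      (hquad w).continuousAt.tendsto.mono_left nhdsWithin_le_nhds
    refine ge_of_tendsto hl ?_
    filter_upwards [Ioo_mem_nhdsLT ht] with r hr
    exact (hpos r ⟨hr.1.le, hr.2⟩ w hw).le
  -- By continuity `N t` is still positive semidefinite, and a null direction of a semidefinite form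
  -- lies in the kernel.
  have hNy : N t *ᵥ y = 0 := by
    have hpsd : (N t).PosSemidef :=
      (posSemidef_sub_smul_one_iff _ _).2 ⟨hsymm t ht0, fun w => by linarith [hnn w, hNq t w]⟩
    refine (hpsd.dotProduct_mulVec_zero_iff y).1 ?_
    rw [star_trivial]
    exact le_antisymm hfy' (hnn y)
  have hPy : P t *ᵥ y = p • y := by
    rw [sub_mulVec, smul_mulVec, one_mulVec, sub_eq_zero] at hNy
    exact hNy
  have hd := nonpos_of_hasDerivAt_of_left_ge (hquad y) ht fun r hr =>
    hfy'.trans (hpos r hr y hy).le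
  rw [quadForm_riccati (hsymm t ht0), hPy, mulVec_smul, dotProduct_smul, mulVec_smul,
    mulVec_smul, dotProduct_smul, smul_dotProduct, smul_eq_mul, smul_eq_mul, smul_eq_mul] at hd
  have h1 := (abs_le.1 ((abs_quadForm_le (A t) y).trans
    (mul_le_mul_of_nonneg_right (hA t ht0) hy0.le))).1
  have h2 := (abs_le.1 ((abs_quadForm_le _ y).trans
    (mul_le_mul_of_nonneg_right (hQ t ht0) hy0.le))).2
  rw [← mulVec_mulVec, ← mulVec_mulVec, transpose_quadForm, dotProduct_comm] at h2
  have h3 := hSε t ht0 y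
  have h4 : p ^ 2 * ((C t *ᵥ y) ⬝ᵥ D t *ᵥ (C t *ᵥ y)) ≤ p ^ 2 * (q * (y ⬝ᵥ y)) := by
    gcongr
  have h5 : p * (-(a * (y ⬝ᵥ y))) ≤ p * (y ⬝ᵥ A t *ᵥ y) := by gcongr
  have h6 := mul_pos (sub_pos.2 hpε) hy0
  nlinarith

end Riccati

/-! ### Riccati equation: uniform upper bound by duality -/

section UpperBound

variable {n m : Type*} [Fintype n] [Fintype m] [DecidableEq n] [DecidableEq m]
  {A : ℝ → Matrix n n ℝ} {C : ℝ → Matrix m n ℝ} {S : ℝ → Matrix n n ℝ}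
  {D : ℝ → Matrix m m ℝ} {P : ℝ → Matrix n n ℝ}

/-- The adjoint system `ṗ = -Aᵀ p + Cᵀ u` can be steered from the origin to any state over every
time window of length `δ`, with state and control bounded by a multiple of the target. -/
def AdjointControllable (A : ℝ → Matrix n n ℝ) (C : ℝ → Matrix m n ℝ) (δ : ℝ) : Prop :=
  ∃ B : ℝ, ∀ t, 0 ≤ t → ∀ ξ : n → ℝ, ∃ (p : ℝ → n → ℝ) (u : ℝ → m → ℝ),
    p t = 0 ∧ p (t + δ) = ξ ∧ ∀ s ∈ Icc t (t + δ),
      HasDerivWithinAt p (-((A s)ᵀ *ᵥ p s) + (C s)ᵀ *ᵥ u s) (Icc t (t + δ)) s ∧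
      p s ⬝ᵥ p s ≤ B * (ξ ⬝ᵥ ξ) ∧ u s ⬝ᵥ u s ≤ B * (ξ ⬝ᵥ ξ)

/-- Completing the square: expand `|u - ε w|² ≥ 0`. -/
theorem two_mul_dotProduct_sub_le {m : Type*} [Fintype m] {ε : ℝ} (hε : 0 < ε)
    (u w : m → ℝ) : 2 * (u ⬝ᵥ w) - ε * (w ⬝ᵥ w) ≤ (u ⬝ᵥ u) / ε := by
  have h := dotProduct_self_nonneg_real (u - ε • w)
  simp only [sub_dotProduct, dotProduct_sub, smul_dotProduct, dotProduct_smul, smul_eq_mul] at h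
  rw [dotProduct_comm w u] at h
  rw [le_div_iff₀ hε]
  nlinarith

theorem IsRiccatiSolution.exists_upper_bound (hA : BoundedMat A) (hC : BoundedMat C)
    (hS : IsWeight S) (hD : IsWeight D) (hP : IsRiccatiSolution A C S D P) {δ : ℝ} (hδ : 0 < δ)
    (hctrl : AdjointControllable A C δ) :
    ∃ q : ℝ, 0 < q ∧ ∀ t, 0 ≤ t → ∀ x : n → ℝ, x ⬝ᵥ P t *ᵥ x ≤ q * (x ⬝ᵥ x) := by
  have hsymm : ∀ t, 0 ≤ t → (P t)ᵀ = P t := fun t ht => hP.symm hA hC hS hD ht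
  obtain ⟨B₀, hB₀⟩ := isCompact_Icc.exists_bound_of_continuousOn
    (hP.continuousOn.mono (Icc_subset_Ici_self : Icc 0 δ ⊆ Ici 0))
  obtain ⟨B, hB⟩ := hctrl
  obtain ⟨σ, hσ, hSσ⟩ := hS.boundedMat
  obtain ⟨ε, hε, hDε⟩ := hD.lower_bound
  refine ⟨max (max B₀ ((B / ε + σ * B) * δ)) 1, by positivity, fun t ht x => ?_⟩
  have hx := dotProduct_self_nonneg_real x
  refine le_trans ?_ (mul_le_mul_of_nonneg_right (le_max_left _ _) hx)
  -- Up to time `δ` compactness bounds `P`; afterwards a full steering window `[t - δ, t]` is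
  -- available.
  rcases le_total t δ with htδ | htδ
  · refine le_trans ?_ (mul_le_mul_of_nonneg_right (le_max_left _ _) hx)
    exact (le_abs_self _).trans ((abs_quadForm_le _ _).trans
      (mul_le_mul_of_nonneg_right (hB₀ t ⟨ht, htδ⟩) hx))
  refine le_trans ?_ (mul_le_mul_of_nonneg_right (le_max_right _ _) hx)
  obtain ⟨r, rfl⟩ : ∃ r, t = r + δ := ⟨t - δ, by ring⟩
  have hr : 0 ≤ r := by linarith
  obtain ⟨p, u, hp0, hp1, hpu⟩ := hB r hr x
  have hder : ∀ s ∈ Icc r (r + δ), HasDerivWithinAt (fun s => p s ⬝ᵥ P s *ᵥ p s)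
      (2 * (u s ⬝ᵥ C s *ᵥ (P s *ᵥ p s)) -
        (C s *ᵥ (P s *ᵥ p s)) ⬝ᵥ D s *ᵥ (C s *ᵥ (P s *ᵥ p s)) + p s ⬝ᵥ S s *ᵥ p s)
      (Icc r (r + δ)) s := by
    intro s hs
    have hs0 : 0 ≤ s := hr.trans hs.1
    have h := HasDerivWithinAt.quadForm ((hP.hasDerivWithinAt hs0).mono
      (Icc_subset_Ici_self.trans (Ici_subset_Ici.2 hr))) (hpu s hs).1
    convert h using 1
    rw [dotProduct_add, quadForm_riccati (hsymm s hs0),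
      symm_dotProduct (hsymm s hs0) (p s) (-_ + _), add_dotProduct, neg_dotProduct,
      dotProduct_comm (_ᵀ *ᵥ p s), transpose_quadForm, dotProduct_comm (_ᵀ *ᵥ u s),
      transpose_quadForm]
    ring
  -- `pᵀ P p` starts from `0` because `p` does, and its growth rate is at most `|u|² / ε + σ |p|²`.
  have key := image_le_of_deriv_right_le_deriv_boundary
    (f := fun s => p s ⬝ᵥ P s *ᵥ p s) (a := r) (b := r + δ)
    (B := fun s => (B / ε + σ * B) * (x ⬝ᵥ x) * (s - r))
    (B' := fun _ => (B / ε + σ * B) * (x ⬝ᵥ x))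
    (fun s hs => (hder s hs).continuousWithinAt)
    (fun s hs => (hder s ⟨hs.1, hs.2.le⟩).mono_of_mem_nhdsWithin
      (mem_of_superset (Icc_mem_nhdsGE hs.2) (Icc_subset_Icc_left hs.1)))
    (by simp [hp0]) (by fun_prop)
    (fun s _ => by
      simpa using (((hasDerivAt_id s).sub_const r).const_mul
        ((B / ε + σ * B) * (x ⬝ᵥ x))).hasDerivWithinAt)
    ?_ ⟨by linarith, le_rfl⟩ (x := r + δ)
  · simp only [hp1] at key
    refine key.trans (le_of_eq ?_)
    ring
  · intro s hs
    have hs' : s ∈ Icc r (r + δ) := ⟨hs.1, hs.2.le⟩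
    have hs0 : 0 ≤ s := hr.trans hs.1
    obtain ⟨-, h1, h2⟩ := hpu s hs'
    have h3 := hDε s hs0 (C s *ᵥ (P s *ᵥ p s))
    have h4 := two_mul_dotProduct_sub_le hε (u s) (C s *ᵥ (P s *ᵥ p s))
    have h5 : (u s ⬝ᵥ u s) / ε ≤ B * (x ⬝ᵥ x) / ε := by gcongr
    have h6 : p s ⬝ᵥ S s *ᵥ p s ≤ σ * (B * (x ⬝ᵥ x)) :=
      (le_abs_self _).trans ((abs_quadForm_le _ _).trans
        (mul_le_mul (hSσ s hs0) h1 (dotProduct_self_nonneg_real _) hσ))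
    have h7 : (B / ε + σ * B) * (x ⬝ᵥ x) = B * (x ⬝ᵥ x) / ε + σ * (B * (x ⬝ᵥ x)) := by ring
    rw [h7]
    linarith

/-- Coercivity gives injectivity, hence surjectivity in finite dimension, and `κ |ζ|² ≤ ζ · G ζ ≤
|ζ| |η|` bounds the preimage. -/
theorem exists_mulVec_eq_of_lower_bound {G : Matrix n n ℝ} {κ : ℝ} (hκ : 0 < κ)
    (hG : ∀ x : n → ℝ, κ * (x ⬝ᵥ x) ≤ x ⬝ᵥ G *ᵥ x) (η : n → ℝ) :
    ∃ ζ : n → ℝ, G *ᵥ ζ = η ∧ κ ^ 2 * (ζ ⬝ᵥ ζ) ≤ η ⬝ᵥ η := by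
  have hinj : Function.Injective G.mulVec := by
    intro x y hxy
    have h0 : G *ᵥ (x - y) = 0 := by rw [mulVec_sub]; exact sub_eq_zero.2 hxy
    have h1 := hG (x - y)
    rw [h0, dotProduct_zero] at h1
    by_contra hne
    exact absurd h1 (not_le.2 (mul_pos hκ (dotProduct_self_pos (sub_ne_zero.2 hne))))
  obtain ⟨ζ, hζ⟩ := mulVec_surjective_iff_isUnit.2 (mulVec_injective_iff_isUnit.1 hinj) η
  refine ⟨ζ, hζ, ?_⟩
  have h1 := hG ζ
  rw [hζ] at h1
  have h2 := (le_abs_self _).trans (abs_dotProduct_le ζ η)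
  rw [← eucNorm_sq, ← eucNorm_sq] at *
  have hz := eucNorm_nonneg ζ
  have h3 : κ * eucNorm ζ ≤ eucNorm η := by
    rcases hz.eq_or_lt with h0 | h0
    · rw [← h0, mul_zero]; exact eucNorm_nonneg η
    · refine le_of_mul_le_mul_left ?_ h0
      calc _ = κ * eucNorm ζ ^ 2 := by ring
        _ ≤ _ := h1.trans h2
  rw [← mul_pow]
  exact pow_le_pow_left₀ (by positivity) h3 2

/-- A uniform lower bound on the observability Gramian steers the adjoint system. Here `Ψ(s, t)` is
the transition matrix of the adjoint system, the inverse transpose of `Φ(s, t)`. -/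
theorem AdjointControllable.of_gramian {Φ Ψ : ℝ → ℝ → Matrix n n ℝ} {δ μ B : ℝ}
    (hδ : 0 < δ) (hμ : 0 < μ) (hB : 0 ≤ B) (hC : BoundedMat C) (hCc : ContinuousOn C (Ici 0))
    (hΦc : ∀ t, 0 ≤ t → ContinuousOn (fun s => Φ s t) (Ici t))
    (hΨ : ∀ t, 0 ≤ t → ∀ s, t ≤ s →
      HasDerivWithinAt (fun r => Ψ r t) (-(A s)ᵀ * Ψ s t) (Ici t) s)
    (hΨΦ : ∀ t s, 0 ≤ t → t ≤ s → Ψ s t * (Φ s t)ᵀ = 1)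
    (hΦB : ∀ t s, 0 ≤ t → s ∈ Icc t (t + δ) → ‖Φ s t‖ ≤ B)
    (hΨB : ∀ t s, 0 ≤ t → s ∈ Icc t (t + δ) → ‖Ψ s t‖ ≤ B)
    (hG : ∀ t, 0 ≤ t → (gramian Φ C δ t - μ • (1 : Matrix n n ℝ)).PosSemidef) :
    AdjointControllable A C δ := by
  obtain ⟨c, hc, hCc'⟩ := hC
  let F : ℝ → ℝ → Matrix n n ℝ := fun t s => (Φ s t)ᵀ * (C s)ᵀ * C s * Φ s t
  let κ : ℝ := δ * μ
  have hκ : 0 < κ := mul_pos hδ hμ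
  let L : ℝ := B * c * c * B * δ
  have hL : 0 ≤ L := by positivity
  refine ⟨(B ^ 2 * L ^ 2 + c ^ 2 * B ^ 2) * (B ^ 2 / κ ^ 2), fun t ht ξ => ?_⟩
  have hlast : t + δ ∈ Icc t (t + δ) := ⟨by linarith, le_rfl⟩
  have hfirst : t ∈ Icc t (t + δ) := ⟨le_rfl, by linarith⟩
  have hsub : Icc t (t + δ) ⊆ Ici t := Icc_subset_Ici_self
  have hΦcont : ContinuousOn (fun s => Φ s t) (Icc t (t + δ)) := (hΦc t ht).mono hsub
  have hCcont : ContinuousOn C (Icc t (t + δ)) := hCc.mono (hsub.trans (Ici_subset_Ici.2 ht))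
  have hFcont : ContinuousOn (F t) (Icc t (t + δ)) := by
    rw [continuousOn_iff_continuous_domRestrict] at *
    exact ((hΦcont.matrix_transpose.matrix_mul hCcont.matrix_transpose).matrix_mul
      hCcont).matrix_mul hΦcont
  have hFB : ∀ s ∈ Icc t (t + δ), ‖F t s‖ ≤ B * c * c * B := by
    intro s hs
    have h1 := hΦB t s ht hs
    have h2 := hCc' s (ht.trans hs.1)
    refine (l2_opNorm_mul _ _).trans (mul_le_mul ?_ h1 (norm_nonneg _) (by positivity))
    refine (l2_opNorm_mul _ _).trans (mul_le_mul ?_ h2 (norm_nonneg _) (by positivity))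
    refine (l2_opNorm_mul _ _).trans (mul_le_mul ?_ ?_ (norm_nonneg _) (by positivity))
    · rwa [norm_transpose]
    · rwa [norm_transpose]
  let G : ℝ → Matrix n n ℝ := fun s => matIntegral (F t) t s
  have hGd : ∀ s ∈ Icc t (t + δ), HasDerivWithinAt G (F t s) (Icc t (t + δ)) s := fun s hs =>
    hasDerivWithinAt_matIntegral hFcont hs
  have hG0 : G t = 0 := by
    ext i j
    exact intervalIntegral.integral_same
  have hGB : ∀ s ∈ Icc t (t + δ), ‖G s‖ ≤ L := by
    intro s hs
    have h := (convex_Icc t (t + δ)).norm_image_sub_le_of_norm_hasDerivWithin_le hGd hFB hfirst hs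
    rw [hG0, sub_zero] at h
    refine h.trans (mul_le_mul_of_nonneg_left ?_ (by positivity))
    rw [Real.norm_of_nonneg (by linarith [hs.1])]
    linarith [hs.2]
  have hGlow : ∀ x : n → ℝ, κ * (x ⬝ᵥ x) ≤ x ⬝ᵥ G (t + δ) *ᵥ x := by
    intro x
    have h := ((posSemidef_sub_smul_one_iff _ _).1 (hG t ht)).2 x
    rw [gramian, smul_mulVec, dotProduct_smul, smul_eq_mul, one_div, inv_mul_eq_div,
      le_div_iff₀ hδ] at h
    calc _ = μ * (x ⬝ᵥ x) * δ := by simp only [κ]; ring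
      _ ≤ _ := h
  -- Since `Ψ` inverts `Φᵀ`, this choice of `ζ` makes the endpoint `Ψ (t + δ) t *ᵥ (G (t + δ) *ᵥ ζ)`
  -- equal to `ξ`.
  obtain ⟨ζ, hζ, hζle⟩ := exists_mulVec_eq_of_lower_bound hκ hGlow ((Φ (t + δ) t)ᵀ *ᵥ ξ)
  have hζξ : ζ ⬝ᵥ ζ ≤ B ^ 2 / κ ^ 2 * (ξ ⬝ᵥ ξ) := by
    have h1 := dotProduct_self_mulVec_le (Φ (t + δ) t)ᵀ ξ
    rw [norm_transpose] at h1
    have h2 : ‖Φ (t + δ) t‖ ^ 2 * (ξ ⬝ᵥ ξ) ≤ B ^ 2 * (ξ ⬝ᵥ ξ) :=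
      mul_le_mul_of_nonneg_right (pow_le_pow_left₀ (norm_nonneg _) (hΦB _ _ ht hlast) 2)
        (dotProduct_self_nonneg_real _)
    rw [div_mul_eq_mul_div, le_div_iff₀ (by positivity)]
    linarith
  have hζ0 := dotProduct_self_nonneg_real ζ
  -- Variation of constants with the control `u = C Φ ζ`: differentiating `G` contributes `Ψ Φᵀ Cᵀ C
  -- Φ ζ = Cᵀ u`.
  refine ⟨fun s => Ψ s t *ᵥ (G s *ᵥ ζ), fun s => C s *ᵥ (Φ s t *ᵥ ζ), ?_,
    ?_, fun s hs => ⟨?_, ?_, ?_⟩⟩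
  · simp only [hG0, zero_mulVec, mulVec_zero]
  · simp only [hζ, mulVec_mulVec, hΨΦ t (t + δ) ht hlast.1, one_mulVec]
  · have h1 := HasDerivWithinAt.matrixMulVec ((hΨ t ht s hs.1).mono hsub)
      (HasDerivWithinAt.matrixMulVec (hGd s hs) (hasDerivWithinAt_const s _ ζ))
    convert h1 using 1
    simp only [F, mulVec_zero, add_zero, mulVec_mulVec, neg_mulVec, neg_mul, Matrix.mul_assoc]
    rw [← Matrix.mul_assoc (Ψ s t), hΨΦ t s ht hs.1, Matrix.one_mul]
  · have h1 := dotProduct_self_mulVec_le (Ψ s t) (G s *ᵥ ζ)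
    have h2 := dotProduct_self_mulVec_le (G s) ζ
    calc _ ≤ B ^ 2 * (L ^ 2 * (ζ ⬝ᵥ ζ)) := by
          refine h1.trans (mul_le_mul (pow_le_pow_left₀ (norm_nonneg _) (hΨB _ _ ht hs) 2)
            (h2.trans ?_) (dotProduct_self_nonneg_real _) (by positivity))
          exact mul_le_mul_of_nonneg_right (pow_le_pow_left₀ (norm_nonneg _) (hGB s hs) 2) hζ0
      _ = B ^ 2 * L ^ 2 * (ζ ⬝ᵥ ζ) := by ring
      _ ≤ (B ^ 2 * L ^ 2 + c ^ 2 * B ^ 2) * (ζ ⬝ᵥ ζ) :=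
          mul_le_mul_of_nonneg_right (le_add_of_nonneg_right (by positivity)) hζ0
      _ ≤ _ := by
          rw [mul_assoc _ (B ^ 2 / κ ^ 2)]
          exact mul_le_mul_of_nonneg_left hζξ (by positivity)
  · have h1 := dotProduct_self_mulVec_le (C s) (Φ s t *ᵥ ζ)
    have h2 := dotProduct_self_mulVec_le (Φ s t) ζ
    calc _ ≤ c ^ 2 * (B ^ 2 * (ζ ⬝ᵥ ζ)) := by
          refine h1.trans (mul_le_mul (pow_le_pow_left₀ (norm_nonneg _) (hCc' s (ht.trans hs.1)) 2)
            (h2.trans ?_) (dotProduct_self_nonneg_real _) (by positivity))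
          exact mul_le_mul_of_nonneg_right (pow_le_pow_left₀ (norm_nonneg _) (hΦB _ _ ht hs) 2) hζ0
      _ = c ^ 2 * B ^ 2 * (ζ ⬝ᵥ ζ) := by ring
      _ ≤ (B ^ 2 * L ^ 2 + c ^ 2 * B ^ 2) * (ζ ⬝ᵥ ζ) :=
          mul_le_mul_of_nonneg_right (le_add_of_nonneg_left (by positivity)) hζ0
      _ ≤ _ := by
          rw [mul_assoc _ (B ^ 2 / κ ^ 2)]
          exact mul_le_mul_of_nonneg_left hζξ (by positivity)

end UpperBound

/-! ### Lyapunov function `xᵀ P⁻¹ x` and exponential stability -/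

section Stability

/-- For `x = P y` this compares `|x|²` with `xᵀ P⁻¹ x` without inverting `P`. The lower estimate
expands `|P y - p y|² ≥ 0`; the upper one evaluates the form of `P` at `q y - P y`. -/
theorem inv_quadForm_bounds {n : Type*} [Fintype n] {P : Matrix n n ℝ} (hPs : Pᵀ = P)
    {p q : ℝ} (hp : 0 < p) (hq : 0 < q)
    (hlow : ∀ x : n → ℝ, p * (x ⬝ᵥ x) ≤ x ⬝ᵥ P *ᵥ x)
    (hupp : ∀ x : n → ℝ, x ⬝ᵥ P *ᵥ x ≤ q * (x ⬝ᵥ x)) (y : n → ℝ) :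
    p * ((P *ᵥ y) ⬝ᵥ y) ≤ (P *ᵥ y) ⬝ᵥ (P *ᵥ y) ∧
      (P *ᵥ y) ⬝ᵥ (P *ᵥ y) ≤ q * ((P *ᵥ y) ⬝ᵥ y) := by
  have hy := dotProduct_self_nonneg_real y
  constructor
  · have h1 := dotProduct_self_nonneg_real (P *ᵥ y - p • y)
    have h2 := hlow y
    simp only [sub_dotProduct, dotProduct_sub, smul_dotProduct, dotProduct_smul, smul_eq_mul] at h1
    rw [dotProduct_comm y (P *ᵥ y)] at h1 h2
    nlinarith [mul_le_mul_of_nonneg_left h2 hp.le]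
  · have h1 := hlow (q • y - P *ᵥ y)
    have h2 := hupp (P *ᵥ y)
    have h3 := mul_nonneg hp.le (dotProduct_self_nonneg_real (q • y - P *ᵥ y))
    have h4 : y ⬝ᵥ P *ᵥ (P *ᵥ y) = (P *ᵥ y) ⬝ᵥ (P *ᵥ y) := by
      rw [symm_dotProduct hPs]
    simp only [mulVec_sub, mulVec_smul, sub_dotProduct, dotProduct_sub, smul_dotProduct,
      dotProduct_smul, smul_eq_mul] at h1 h3
    rw [h4, dotProduct_comm y (P *ᵥ y)] at h1
    rw [dotProduct_comm y (P *ᵥ y)] at h3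
    have h5 : q * ((P *ᵥ y) ⬝ᵥ (P *ᵥ y)) ≤ q * (q * ((P *ᵥ y) ⬝ᵥ y)) := by nlinarith
    exact le_of_mul_le_mul_left h5 hq

variable {n m : Type*} [Fintype n] [Fintype m] [DecidableEq n] [DecidableEq m]
  {A : ℝ → Matrix n n ℝ} {C : ℝ → Matrix m n ℝ} {S : ℝ → Matrix n n ℝ}
  {D : ℝ → Matrix m m ℝ} {P : ℝ → Matrix n n ℝ}

theorem IsRiccatiSolution.globallyExponentiallyStable (hA : BoundedMat A) (hC : BoundedMat C)
    (hS : IsWeight S) (hD : IsWeight D) (hP : IsRiccatiSolution A C S D P) {δ : ℝ} (hδ : 0 < δ)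
    (hctrl : AdjointControllable A C δ) :
    GloballyExponentiallyStable fun t => A t - gain C D P t * C t := by
  have hsymm : ∀ t, 0 ≤ t → (P t)ᵀ = P t := fun t ht => hP.symm hA hC hS hD ht
  obtain ⟨p, hp, hlow⟩ := hP.exists_lower_bound hA hC hS hD
  obtain ⟨q, hq, hupp⟩ := hP.exists_upper_bound hA hC hS hD hδ hctrl
  obtain ⟨ε, hε, hSε⟩ := hS.lower_bound
  obtain ⟨d, hd, hDd⟩ := hD.lower_bound
  have hunit : ∀ t, 0 ≤ t → IsUnit (P t) := fun t ht =>
    (PosDef.of_lower_bound (hsymm t ht) hp (hlow t ht)).isUnit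
  have hβ : 0 < ε / q := div_pos hε hq
  -- `V` decays at rate `ε / q` and `p V ≤ |x|² ≤ q V`; the square root halves the rate.
  refine ⟨√(q / p), ε / q / 2, by positivity, by positivity, fun t₀ t₁ x ht₀ hx t ht => ?_⟩
  let y : ℝ → n → ℝ := fun r => (P r)⁻¹ *ᵥ x r
  have hPy : ∀ r, 0 ≤ r → P r *ᵥ y r = x r := fun r hr => by
    simp only [y, mulVec_mulVec]
    rw [mul_nonsing_inv _ ((isUnit_iff_isUnit_det _).1 (hunit r hr)), one_mulVec]
  have hinvs : ∀ r, 0 ≤ r → ((P r)⁻¹)ᵀ = (P r)⁻¹ := fun r hr => by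
    rw [transpose_nonsing_inv, hsymm r hr]
  let V : ℝ → ℝ := fun r => x r ⬝ᵥ (P r)⁻¹ *ᵥ x r
  let W : ℝ → ℝ := fun r =>
    -((C r *ᵥ x r) ⬝ᵥ D r *ᵥ (C r *ᵥ x r)) - y r ⬝ᵥ S r *ᵥ y r
  have hV : ∀ r ∈ Icc t₀ t₁, HasDerivWithinAt V (W r) (Icc t₀ t₁) r := by
    intro r hr
    have hr0 : 0 ≤ r := ht₀.trans hr.1
    have h := HasDerivWithinAt.quadForm (HasDerivWithinAt.matrixInv
      ((hP.hasDerivWithinAt hr0).mono (Icc_subset_Ici_self.trans (Ici_subset_Ici.2 ht₀)))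
      (hunit r hr0)) (hx r hr)
    convert h using 1
    have e1 : (P r)⁻¹ *ᵥ x r = y r := rfl
    beta_reduce
    rw [dotProduct_add, symm_dotProduct (hinvs r hr0) (x r) (_ *ᵥ _), neg_mulVec, dotProduct_neg,
      ← mulVec_mulVec, ← mulVec_mulVec, e1, symm_dotProduct (hinvs r hr0) (x r), e1,
      dotProduct_comm _ (y r), dotProduct_comm (_ *ᵥ y r) (y r),
      quadForm_riccati (hsymm r hr0), hPy r hr0, sub_mulVec,
      dotProduct_sub]
    have e2 : y r ⬝ᵥ (gain C D P r * C r) *ᵥ x r =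
        (C r *ᵥ x r) ⬝ᵥ D r *ᵥ (C r *ᵥ x r) := by
      simp only [gain, ← mulVec_mulVec]
      rw [symm_dotProduct (hsymm r hr0), hPy r hr0, dotProduct_comm (_ᵀ *ᵥ _),
        transpose_quadForm, dotProduct_comm]
    rw [e2]
    simp only [W]
    ring
  have hVbd : ∀ r, 0 ≤ r → p * V r ≤ x r ⬝ᵥ x r ∧ x r ⬝ᵥ x r ≤ q * V r := fun r hr => by
    have := inv_quadForm_bounds (hsymm r hr) hp hq (hlow r hr) (hupp r hr) (y r)
    rwa [hPy r hr] at this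
  -- The term in `D` only helps, and `yᵀ S y ≥ ε |y|² ≥ (ε / q) yᵀ P y = (ε / q) V`.
  have hW : ∀ r, 0 ≤ r → W r ≤ -(ε / q) * V r := by
    intro r hr
    have h1 := hSε r hr (y r)
    have h2 := hDd r hr (C r *ᵥ x r)
    have h3 := mul_nonneg hd.le (dotProduct_self_nonneg_real (C r *ᵥ x r))
    have h4 := hupp r hr (y r)
    rw [hPy r hr, dotProduct_comm] at h4
    have h5 : ε / q * V r ≤ ε * (y r ⬝ᵥ y r) := by
      calc _ ≤ ε / q * (q * (y r ⬝ᵥ y r)) := mul_le_mul_of_nonneg_left h4 hβ.le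
        _ = _ := by field_simp
    simp only [W]
    linarith
  have hanti : AntitoneOn (fun r => Real.exp (ε / q * r) * V r) (Icc t₀ t₁) := by
    have hder : ∀ r ∈ Icc t₀ t₁, HasDerivWithinAt (fun r => Real.exp (ε / q * r) * V r)
        (Real.exp (ε / q * r) * (ε / q) * V r + Real.exp (ε / q * r) * W r) (Icc t₀ t₁) r := by
      intro r hr
      have h1 : HasDerivAt (fun r => Real.exp (ε / q * r)) (Real.exp (ε / q * r) * (ε / q)) r := by
        simpa using ((hasDerivAt_id r).const_mul (ε / q)).exp
      exact h1.hasDerivWithinAt.fun_mul (hV r hr)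
    refine antitoneOn_of_hasDerivWithinAt_nonpos (convex_Icc _ _)
      (fun r hr => (hder r hr).continuousWithinAt)
      (fun r hr => (hder r (interior_subset hr)).mono interior_subset) fun r hr => ?_
    have h1 := hW r (ht₀.trans (interior_subset hr).1)
    have h2 := mul_le_mul_of_nonneg_left h1 (Real.exp_pos (ε / q * r)).le
    linarith
  have hle := hanti ⟨le_rfl, ht.1.trans ht.2⟩ ht ht.1
  simp only at hle
  have hVt : V t ≤ Real.exp (-(ε / q) * (t - t₀)) * V t₀ := by
    have h1 : Real.exp (-(ε / q) * (t - t₀)) =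
        Real.exp (ε / q * t₀) * Real.exp (-(ε / q * t)) := by
      rw [← Real.exp_add]; congr 1; ring
    have h2 := mul_le_mul_of_nonneg_right hle (Real.exp_pos (-(ε / q * t))).le
    have h3 : Real.exp (ε / q * t) * Real.exp (-(ε / q * t)) = 1 := by
      rw [← Real.exp_add, add_neg_cancel, Real.exp_zero]
    rw [h1]
    calc V t = Real.exp (ε / q * t) * V t * Real.exp (-(ε / q * t)) := by
          rw [mul_right_comm, h3, one_mul]
      _ ≤ _ := h2
      _ = _ := by ring
  have h0 := (hVbd t₀ ht₀).1
  have h1 := (hVbd t (ht₀.trans ht.1)).2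
  have hfin : x t ⬝ᵥ x t ≤ q / p * Real.exp (-(ε / q) * (t - t₀)) * (x t₀ ⬝ᵥ x t₀) := by
    have h2 : V t₀ ≤ (x t₀ ⬝ᵥ x t₀) / p := by rw [le_div_iff₀ hp]; linarith
    calc _ ≤ q * V t := h1
      _ ≤ q * (Real.exp (-(ε / q) * (t - t₀)) * ((x t₀ ⬝ᵥ x t₀) / p)) :=
          mul_le_mul_of_nonneg_left (hVt.trans
            (mul_le_mul_of_nonneg_left h2 (Real.exp_pos _).le)) hq.le
      _ = _ := by ring
  have hres := eucNorm_le_sqrt_mul (by positivity) hfin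
  rw [Real.sqrt_mul (by positivity), ← Real.exp_half] at hres
  convert hres using 4
  ring

end Stability

/-! ### Persistent excitation along affine motions -/

section Excitation

variable {n : Type*} [Fintype n] {Γ : ℝ → Matrix n n ℝ} {δ μ : ℝ}

theorem projection_dotProduct {A : Matrix n n ℝ} (hs : Aᵀ = A) (hi : A * A = A) (w : n → ℝ) :
    (A *ᵥ w) ⬝ᵥ (A *ᵥ w) = w ⬝ᵥ A *ᵥ w := by
  rw [← symm_dotProduct hs w (A *ᵥ w), mulVec_mulVec, hi]

theorem projection_dotProduct_le {A : Matrix n n ℝ} (hs : Aᵀ = A) (hi : A * A = A) (w : n → ℝ) :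
    (A *ᵥ w) ⬝ᵥ (A *ᵥ w) ≤ w ⬝ᵥ w := by
  have h := dotProduct_self_nonneg_real (w - A *ᵥ w)
  simp only [sub_dotProduct, dotProduct_sub] at h
  rw [dotProduct_comm (A *ᵥ w) w, ← projection_dotProduct hs hi] at h
  linarith

/-- This is `|x + y|² ≥ |x|² / 2 - |y|²` with `x = A c` and `y = r A b`, as a projection does not
lengthen `b`. -/
theorem projection_affine_lower_bound {A : Matrix n n ℝ} (hs : Aᵀ = A) (hi : A * A = A)
    (c b : n → ℝ) (r : ℝ) :
    1 / 2 * (c ⬝ᵥ A *ᵥ c) - r ^ 2 * (b ⬝ᵥ b) ≤ (A *ᵥ (c + r • b)) ⬝ᵥ (A *ᵥ (c + r • b)) := by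
  have h1 := mul_le_mul_of_nonneg_left (projection_dotProduct_le hs hi b) (sq_nonneg r)
  have h2 := dotProduct_self_nonneg_real (A *ᵥ c + (2 * r) • A *ᵥ b)
  rw [← projection_dotProduct hs hi c]
  simp only [mulVec_add, mulVec_smul, add_dotProduct, dotProduct_add, smul_dotProduct,
    dotProduct_smul, smul_eq_mul] at h2 ⊢
  rw [dotProduct_comm (A *ᵥ b) (A *ᵥ c)] at *
  nlinarith

theorem continuousOn_affine_output (hc : ContinuousOn Γ (Ici 0)) (c b : n → ℝ) {a t : ℝ}
    (ha : 0 ≤ a) (e : ℝ) :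
    ContinuousOn (fun s => (Γ s *ᵥ (c + (s - t) • b)) ⬝ᵥ (Γ s *ᵥ (c + (s - t) • b)))
      (Icc a e) := by
  have h1 := hc.mono (Icc_subset_Ici_self.trans (Ici_subset_Ici.2 ha) : Icc a e ⊆ Ici 0)
  rw [continuousOn_iff_continuous_domRestrict] at *
  have h2 : Continuous fun s : Icc a e => c + ((s : ℝ) - t) • b := by fun_prop
  exact (h1.matrix_mulVec h2).dotProduct (h1.matrix_mulVec h2)

theorem continuousOn_quadForm (hc : ContinuousOn Γ (Ici 0)) (c : n → ℝ) {a : ℝ}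
    (ha : 0 ≤ a) (e : ℝ) : ContinuousOn (fun s => c ⬝ᵥ Γ s *ᵥ c) (Icc a e) := by
  have h1 := hc.mono (Icc_subset_Ici_self.trans (Ici_subset_Ici.2 ha) : Icc a e ⊆ Ici 0)
  rw [continuousOn_iff_continuous_domRestrict] at *
  exact continuous_const.dotProduct (h1.matrix_mulVec continuous_const)

/-- The hypothesis `hcb` says that the displacement `δ b` is small against `c`: the perturbation
then costs at most half of the excitation `δ μ |c|² / 2` left for the constant vector `c`. -/
theorem window_lower_bound (hδ : 0 < δ)
    (hs : ∀ t, 0 ≤ t → (Γ t)ᵀ = Γ t) (hi : ∀ t, 0 ≤ t → Γ t * Γ t = Γ t)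
    (hc : ContinuousOn Γ (Ici 0))
    (hPE : ∀ t, 0 ≤ t → ∀ w : n → ℝ, δ * μ * (w ⬝ᵥ w) ≤ ∫ s in t..t + δ, w ⬝ᵥ Γ s *ᵥ w)
    {t : ℝ} (ht : 0 ≤ t) {c b : n → ℝ} (hcb : 4 * δ ^ 2 * (b ⬝ᵥ b) ≤ μ * (c ⬝ᵥ c)) :
    δ * μ / 4 * (c ⬝ᵥ c) ≤
      ∫ s in t..t + δ, (Γ s *ᵥ (c + (s - t) • b)) ⬝ᵥ (Γ s *ᵥ (c + (s - t) • b)) := by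
  have hle : t ≤ t + δ := by linarith
  have hi1 := (continuousOn_quadForm hc c ht (t + δ)).intervalIntegrable_of_Icc
    (μ := MeasureTheory.volume) hle
  have hi2 := (continuousOn_affine_output hc c b (t := t) ht (t + δ)).intervalIntegrable_of_Icc
    (μ := MeasureTheory.volume) hle
  calc δ * μ / 4 * (c ⬝ᵥ c) ≤ 1 / 2 * (δ * μ * (c ⬝ᵥ c)) - δ * (δ ^ 2 * (b ⬝ᵥ b)) := by
        nlinarith [mul_le_mul_of_nonneg_left hcb hδ.le]
    _ ≤ 1 / 2 * (∫ s in t..t + δ, c ⬝ᵥ Γ s *ᵥ c) - δ * (δ ^ 2 * (b ⬝ᵥ b)) := by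
        linarith [hPE t ht c]
    _ = ∫ s in t..t + δ, (1 / 2 * (c ⬝ᵥ Γ s *ᵥ c) - δ ^ 2 * (b ⬝ᵥ b)) := by
        rw [intervalIntegral.integral_sub (hi1.const_mul _) intervalIntegrable_const,
          intervalIntegral.integral_const_mul, intervalIntegral.integral_const, smul_eq_mul,
          add_sub_cancel_left]
    _ ≤ _ := by
        refine intervalIntegral.integral_mono_on hle
          ((hi1.const_mul _).sub intervalIntegrable_const) hi2 fun s hs' => ?_
        have hs0 : 0 ≤ s := ht.trans hs'.1
        refine le_trans ?_ (projection_affine_lower_bound (hs s hs0) (hi s hs0) c b (s - t))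
        refine sub_le_sub_left (mul_le_mul_of_nonneg_right ?_ (dotProduct_self_nonneg_real b)) _
        exact pow_le_pow_left₀ (by linarith [hs'.1]) (by linarith [hs'.2]) 2

/-- If a projection-valued signal is persistently exciting, it is so uniformly along affine
trajectories `α + (s - t) β`: over a long window, such a trajectory either is nearly constant
at the beginning or has a nearly constant direction at the end. -/
theorem affine_excitation (hδ : 0 < δ) (hμ : 0 < μ)
    (hs : ∀ t, 0 ≤ t → (Γ t)ᵀ = Γ t) (hi : ∀ t, 0 ≤ t → Γ t * Γ t = Γ t)
    (hc : ContinuousOn Γ (Ici 0))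
    (hPE : ∀ t, 0 ≤ t → ∀ w : n → ℝ, δ * μ * (w ⬝ᵥ w) ≤ ∫ s in t..t + δ, w ⬝ᵥ Γ s *ᵥ w) :
    ∃ δ' κ : ℝ, 0 < δ' ∧ 0 < κ ∧ ∀ t, 0 ≤ t → ∀ α β : n → ℝ,
      κ * (α ⬝ᵥ α + β ⬝ᵥ β) ≤
        ∫ s in t..t + δ', (Γ s *ᵥ (α + (s - t) • β)) ⬝ᵥ (Γ s *ᵥ (α + (s - t) • β)) := by
  -- `N ^ 2 * μ ≥ 16` amounts to `(N δ)² ≥ 4 m2` with `m2 = 4 δ² / μ`, the threshold of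
  -- `window_lower_bound`.
  obtain ⟨N, hN⟩ := exists_nat_ge (16 / μ)
  have hN16 : 16 ≤ (N : ℝ) * μ := (div_le_iff₀ hμ).1 hN
  have hN1 : (1 : ℝ) ≤ N := by
    have : (0 : ℝ) < N := lt_of_lt_of_le (by positivity) hN
    exact_mod_cast Nat.pos_of_ne_zero (by rintro rfl; simp at this)
  have hN2 : 16 ≤ (N : ℝ) ^ 2 * μ := by nlinarith
  let κ := δ * μ / 8 * min 1 (4 * δ ^ 2 / μ)
  have hκ : 0 < κ := by positivity
  refine ⟨(N + 1) * δ, κ, by positivity, hκ, fun t ht α β => ?_⟩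
  set m2 := 4 * δ ^ 2 / μ with hm2
  have hm2μ : m2 * μ = 4 * δ ^ 2 := div_mul_cancel₀ _ hμ.ne'
  have hα := dotProduct_self_nonneg_real α
  have hβ := dotProduct_self_nonneg_real β
  have hlow : κ * (α ⬝ᵥ α + β ⬝ᵥ β) ≤ δ * μ / 8 * (α ⬝ᵥ α + m2 * (β ⬝ᵥ β)) := by
    rw [show κ = δ * μ / 8 * min 1 m2 from rfl, mul_assoc, mul_add]
    refine mul_le_mul_of_nonneg_left (add_le_add ?_ ?_) (by positivity)
    · exact mul_le_of_le_one_left hα (min_le_left _ _)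
    · exact mul_le_mul_of_nonneg_right (min_le_right _ _) hβ
  have hint : ∀ (a e : ℝ), t ≤ a → a ≤ e → e ≤ t + (N + 1) * δ →
      (∫ s in a..e, (Γ s *ᵥ (α + (s - t) • β)) ⬝ᵥ (Γ s *ᵥ (α + (s - t) • β))) ≤
        ∫ s in t..t + (N + 1) * δ,
          (Γ s *ᵥ (α + (s - t) • β)) ⬝ᵥ (Γ s *ᵥ (α + (s - t) • β)) := by
    intro a e hta hae he
    refine intervalIntegral.integral_mono_interval hta hae he
      (Eventually.of_forall fun s => dotProduct_self_nonneg_real _) ?_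
    exact (continuousOn_affine_output hc α β ht _).intervalIntegrable_of_Icc
      (hta.trans (hae.trans he))
  -- If `α` dominates, the first window of length `δ` suffices; otherwise the motion has moved far
  -- enough from `α` by the last one, which starts from `c = α + N δ β`.
  rcases le_or_gt (m2 * (β ⬝ᵥ β)) (α ⬝ᵥ α) with hcase | hcase
  · have h1 := window_lower_bound hδ hs hi hc hPE ht (c := α) (b := β)
      (by nlinarith [mul_le_mul_of_nonneg_right hcase hμ.le])
    have h2 := hint t (t + δ) le_rfl (by linarith) (by nlinarith)
    have h3 : δ * μ / 8 * (α ⬝ᵥ α + m2 * (β ⬝ᵥ β)) ≤ δ * μ / 8 * (α ⬝ᵥ α + α ⬝ᵥ α) := by gcongr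
    linarith
  · set c := α + (N * δ) • β with hcdef
    -- `4 m2 |β|² ≤ |c - α|² ≤ 2 |c|² + 2 |α|²`, and `|α|² < m2 |β|²` in this case.
    have hcβ : m2 * (β ⬝ᵥ β) ≤ c ⬝ᵥ c := by
      have h1 := dotProduct_self_nonneg_real (c + α)
      have e : c - α = (N * δ) • β := by rw [hcdef]; abel
      have h2 : (c - α) ⬝ᵥ (c - α) = (N * δ) ^ 2 * (β ⬝ᵥ β) := by
        rw [e, smul_dotProduct, dotProduct_smul, smul_eq_mul, smul_eq_mul]; ring
      simp only [add_dotProduct, dotProduct_add, sub_dotProduct, dotProduct_sub] at h1 h2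
      have h3 : 4 * m2 ≤ (N * δ) ^ 2 := by
        rw [hm2, mul_div_assoc', div_le_iff₀ hμ]
        nlinarith [mul_le_mul_of_nonneg_right hN2 (sq_nonneg δ)]
      have h4 := mul_le_mul_of_nonneg_right h3 hβ
      linarith
    have h1 := window_lower_bound hδ hs hi hc hPE (t := t + N * δ) (by positivity)
      (c := c) (b := β) (by nlinarith [mul_le_mul_of_nonneg_right hcβ hμ.le])
    have e : ∀ s : ℝ, c + (s - (t + N * δ)) • β = α + (s - t) • β := by
      intro s
      rw [hcdef, add_assoc, ← add_smul]
      congr 2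
      ring
    simp only [e] at h1
    have h2 := hint (t + N * δ) (t + N * δ + δ) (by nlinarith) (by linarith) (by linarith)
    have h3 : δ * μ / 8 * (α ⬝ᵥ α + m2 * (β ⬝ᵥ β)) ≤ δ * μ / 8 * (c ⬝ᵥ c + c ⬝ᵥ c) := by
      gcongr
      linarith
    linarith

end Excitation

/-! ### Block matrices and the double integrator -/

section Blocks

variable {s : Set ℝ} {t : ℝ}

theorem HasDerivWithinAt.fromBlocks {m n k l : Type*} [Fintype m] [Fintype n] [Fintype k]
    [Fintype l] {E : ℝ → Matrix m k ℝ} {F : ℝ → Matrix m l ℝ} {G : ℝ → Matrix n k ℝ}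
    {H : ℝ → Matrix n l ℝ} {E' : Matrix m k ℝ} {F' : Matrix m l ℝ} {G' : Matrix n k ℝ}
    {H' : Matrix n l ℝ} (hE : HasDerivWithinAt E E' s t) (hF : HasDerivWithinAt F F' s t)
    (hG : HasDerivWithinAt G G' s t) (hH : HasDerivWithinAt H H' s t) :
    HasDerivWithinAt (fun r => Matrix.fromBlocks (E r) (F r) (G r) (H r))
      (Matrix.fromBlocks E' F' G' H') s t := by
  rw [hasDerivWithinAt_matrix] at *
  rintro (i | i) (j | j)
  · exact hE i j
  · exact hF i j
  · exact hG i j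
  · exact hH i j

theorem skew_transpose (u : V3) : (skew u)ᵀ = -skew u := by
  ext i j
  fin_cases i <;> fin_cases j <;> simp [skew]

/-- The change of coordinates from the inertial to the body frame on `ℝ⁶`. -/
def bodyFrame (R : ℝ → M3) (t : ℝ) : Matrix I6 I6 ℝ := Matrix.fromBlocks (R t)ᵀ 0 0 (R t)ᵀ

/-- The transition matrix of the double integrator `ẋ₁ = x₂`, `ẋ₂ = 0`. -/
def doubleIntegrator (r : ℝ) : Matrix I6 I6 ℝ := Matrix.fromBlocks 1 (r • 1) 0 1

/-- The transition matrix of the adjoint of the double integrator. -/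
def adjointIntegrator (r : ℝ) : Matrix I6 I6 ℝ := Matrix.fromBlocks 1 0 (-r • 1) 1

theorem adjointIntegrator_mul_transpose (r : ℝ) :
    adjointIntegrator r * (doubleIntegrator r)ᵀ = 1 := by
  rw [adjointIntegrator, doubleIntegrator, fromBlocks_transpose, fromBlocks_multiply]
  simp

theorem continuous_doubleIntegrator : Continuous doubleIntegrator :=
  Continuous.matrix_fromBlocks continuous_const (by fun_prop) continuous_const continuous_const

theorem continuous_adjointIntegrator : Continuous adjointIntegrator :=
  Continuous.matrix_fromBlocks continuous_const continuous_const (by fun_prop) continuous_const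

theorem hasDerivWithinAt_doubleIntegrator (a : ℝ) :
    HasDerivWithinAt (fun r => doubleIntegrator (r - a))
      (Matrix.fromBlocks 0 1 0 0 : Matrix I6 I6 ℝ) s t := by
  refine HasDerivWithinAt.fromBlocks (hasDerivWithinAt_const _ _ _) ?_
    (hasDerivWithinAt_const _ _ _) (hasDerivWithinAt_const _ _ _)
  simpa using (((hasDerivAt_id t).sub_const a).hasDerivWithinAt (s := s)).smul_const (1 : M3)

theorem hasDerivWithinAt_adjointIntegrator (a : ℝ) :
    HasDerivWithinAt (fun r => adjointIntegrator (r - a))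
      (Matrix.fromBlocks 0 0 (-1) 0 : Matrix I6 I6 ℝ) s t := by
  refine HasDerivWithinAt.fromBlocks (hasDerivWithinAt_const _ _ _) (hasDerivWithinAt_const _ _ _)
    ?_ (hasDerivWithinAt_const _ _ _)
  simpa using (((hasDerivAt_id t).sub_const a).neg.hasDerivWithinAt (s := s)).smul_const (1 : M3)

end Blocks

/-! ### Observability of the vehicle's error system -/

section Vehicle

variable {g : ℝ} {R : ℝ → M3} {v ω a : ℝ → V3} {t : ℝ}

theorem eucNorm_pos {n : Type*} [Fintype n] {x : n → ℝ} (hx : x ≠ 0) : 0 < eucNorm x :=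
  lt_of_le_of_ne (eucNorm_nonneg x) fun h => (dotProduct_self_pos hx).ne' (by
    rw [← eucNorm_sq, ← h, sq, mul_zero])

theorem proj_of_unit {u : V3} (hu : u ⬝ᵥ u = 1) : proj u = 1 - vecMulVec u u := by
  rw [proj, eucNorm_sq, hu, div_one, one_smul]

theorem proj_transpose (u : V3) : (proj u)ᵀ = proj u := by
  rw [proj, transpose_sub, transpose_one, transpose_smul, transpose_vecMulVec]

theorem proj_mul_self {u : V3} (hu : u ⬝ᵥ u = 1) : proj u * proj u = proj u := by
  rw [proj_of_unit hu, sub_mul, mul_sub, mul_sub, Matrix.one_mul, Matrix.mul_one,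
    vecMulVec_mul_vecMulVec, hu, one_smul]
  simp

theorem IsVehicle.rotation_mul_transpose (h : IsVehicle g R v ω a) (ht : 0 ≤ t) :
    R t * (R t)ᵀ = 1 :=
  (mem_orthogonalGroup_iff (Fin 3) ℝ).1
    (mem_specialOrthogonalGroup_iff.1 (h.rotation t ht)).1

theorem IsVehicle.rotation_transpose_mul (h : IsVehicle g R v ω a) (ht : 0 ≤ t) :
    (R t)ᵀ * R t = 1 :=
  mul_eq_one_comm.1 (h.rotation_mul_transpose ht)

theorem IsVehicle.hasDerivWithinAt_transpose (h : IsVehicle g R v ω a) (ht : 0 ≤ t) :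
    HasDerivWithinAt (fun r => (R r)ᵀ) (-skew (ω t) * (R t)ᵀ) (Ici 0) t := by
  have := HasDerivWithinAt.matrixTranspose (hasMatDerivWithinAt_iff.1 (h.attitude t ht))
  rwa [transpose_mul, skew_transpose] at this

theorem IsVehicle.continuousOn_rotation (h : IsVehicle g R v ω a) : ContinuousOn R (Ici 0) :=
  fun t ht => (hasMatDerivWithinAt_iff.1 (h.attitude t ht)).continuousWithinAt

theorem IsVehicle.continuousOn_velocity (h : IsVehicle g R v ω a) : ContinuousOn v (Ici 0) :=
  fun t ht => (h.velocity t ht).continuousWithinAt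

theorem IsVehicle.inertialDir_eq (h : IsVehicle g R v ω a) (ht : 0 ≤ t) :
    inertialDir R v t = (1 / eucNorm (v t)) • v t := by
  rw [inertialDir, bodyDir, mulVec_mulVec, h.rotation_mul_transpose ht, one_mulVec]

theorem IsVehicle.bodyDir_eq (h : IsVehicle g R v ω a) (ht : 0 ≤ t) :
    bodyDir R v t = (R t)ᵀ *ᵥ inertialDir R v t := by
  rw [h.inertialDir_eq ht, bodyDir]

theorem IsVehicle.inertialDir_unit (h : IsVehicle g R v ω a) (hv : ∀ t, 0 ≤ t → v t ≠ 0)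
    (ht : 0 ≤ t) : inertialDir R v t ⬝ᵥ inertialDir R v t = 1 := by
  have hp := eucNorm_pos (hv t ht)
  rw [h.inertialDir_eq ht, smul_dotProduct, dotProduct_smul, ← eucNorm_sq, smul_eq_mul,
    smul_eq_mul]
  field_simp

theorem IsVehicle.bodyDir_unit (h : IsVehicle g R v ω a) (hv : ∀ t, 0 ≤ t → v t ≠ 0)
    (ht : 0 ≤ t) : bodyDir R v t ⬝ᵥ bodyDir R v t = 1 := by
  rw [← h.inertialDir_unit hv ht, h.bodyDir_eq ht, dotProduct_comm, ← transpose_quadForm,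
    transpose_transpose, mulVec_mulVec, h.rotation_mul_transpose ht, one_mulVec]

theorem IsVehicle.continuousOn_inertialDir (h : IsVehicle g R v ω a)
    (hv : ∀ t, 0 ≤ t → v t ≠ 0) : ContinuousOn (inertialDir R v) (Ici 0) := by
  have hvc := h.continuousOn_velocity
  have hn : ContinuousOn (fun t => eucNorm (v t)) (Ici 0) :=
    ((PiLp.continuous_toLp 2 _).comp_continuousOn hvc).norm
  refine ContinuousOn.congr (f := fun t => (1 / eucNorm (v t)) • v t) ?_
    fun t ht => h.inertialDir_eq ht
  exact (continuousOn_const.div hn fun t ht => (eucNorm_pos (hv t ht)).ne').smul hvc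

theorem IsVehicle.continuousOn_bodyDir (h : IsVehicle g R v ω a)
    (hv : ∀ t, 0 ≤ t → v t ≠ 0) : ContinuousOn (bodyDir R v) (Ici 0) := by
  refine ContinuousOn.congr (f := fun t => (R t)ᵀ *ᵥ inertialDir R v t) ?_
    fun t ht => h.bodyDir_eq ht
  have h1 := h.continuousOn_inertialDir hv
  have h2 := h.continuousOn_rotation
  rw [continuousOn_iff_continuous_domRestrict] at *
  exact h2.matrix_transpose.matrix_mulVec h1

theorem continuousOn_proj {u : ℝ → V3} (hu : ContinuousOn u (Ici 0))
    (hu1 : ∀ t, 0 ≤ t → u t ⬝ᵥ u t = 1) : ContinuousOn (fun t => proj (u t)) (Ici 0) := by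
  refine ContinuousOn.congr (f := fun t => 1 - vecMulVec (u t) (u t)) ?_
    fun t ht => proj_of_unit (hu1 t ht)
  rw [continuousOn_iff_continuous_domRestrict] at *
  exact continuous_const.sub (hu.matrix_vecMulVec hu)

theorem continuousOn_outputMat {u : ℝ → V3} (hu : ContinuousOn u (Ici 0))
    (hu1 : ∀ t, 0 ≤ t → u t ⬝ᵥ u t = 1) : ContinuousOn (outputMat u) (Ici 0) := by
  have h := continuousOn_proj hu hu1
  refine continuousOn_pi.2 fun i => continuousOn_pi.2 ?_
  rintro (j | j)
  · exact continuousOn_entry h i j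
  · exact continuousOn_const

theorem abs_entry_le_eucNorm {n : Type*} [Fintype n] (x : n → ℝ) (i : n) : |x i| ≤ eucNorm x := by
  refine abs_le_of_sq_le_sq ?_ (eucNorm_nonneg x)
  rw [eucNorm_sq, sq]
  exact Finset.single_le_sum (f := fun j => x j * x j) (fun j _ => mul_self_nonneg _)
    (Finset.mem_univ i)

theorem boundedMat_outputMat {u : ℝ → V3} (hu1 : ∀ t, 0 ≤ t → u t ⬝ᵥ u t = 1) :
    BoundedMat (outputMat u) := by
  refine BoundedMat.of_entries ⟨2, fun t ht i j => ?_⟩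
  have hu : eucNorm (u t) = 1 := by
    have := eucNorm_sq (u t)
    rw [hu1 t ht] at this
    nlinarith [eucNorm_nonneg (u t)]
  rcases j with j | j
  · have h1 := abs_entry_le_eucNorm (u t) i
    have h2 := abs_entry_le_eucNorm (u t) j
    rw [hu] at h1 h2
    have h3 : |(1 : M3) i j| ≤ 1 := by
      rw [one_apply]; split_ifs <;> simp
    have h4 : |u t i * u t j| ≤ 1 := by
      rw [abs_mul]; exact mul_le_one₀ h1 (abs_nonneg _) h2
    have h5 := abs_sub ((1 : M3) i j) (u t i * u t j)
    have e : outputMat u t i (Sum.inl j) = (1 : M3) i j - u t i * u t j := by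
      simp only [outputMat, fromCols_apply_inl, proj_of_unit (hu1 t ht), Matrix.sub_apply,
        vecMulVec_apply]
    rw [e]
    linarith
  · simp [outputMat]

theorem boundedMat_stateMat (hω : BoundedVec ω) : BoundedMat (stateMat ω) := by
  obtain ⟨M, hM⟩ := hω
  refine BoundedMat.of_entries ⟨max M 1, fun t ht i j => ?_⟩
  have h : ∀ k, |ω t k| ≤ max M 1 := fun k =>
    (abs_entry_le_eucNorm _ k).trans ((hM t ht).trans (le_max_left _ _))
  have h0 : (0 : ℝ) ≤ max M 1 := zero_le_one.trans (le_max_right _ _)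
  have hsk : ∀ k l, |(-skew (ω t)) k l| ≤ max M 1 := by
    intro k l
    rw [Matrix.neg_apply, abs_neg]
    fin_cases k <;> fin_cases l <;> simp only [skew] <;> simp [h, -le_sup_iff, h0]
  rcases i with i | i <;> rcases j with j | j
  · exact hsk i j
  · simp only [stateMat, fromBlocks_apply₁₂, one_apply]
    split_ifs
    · simp
    · simp [-le_sup_iff, h0]
  · simp [stateMat, -le_sup_iff, h0]
  · exact hsk i j

theorem IsVehicle.bodyFrame_mul_transpose (h : IsVehicle g R v ω a) (ht : 0 ≤ t) :
    bodyFrame R t * (bodyFrame R t)ᵀ = 1 := by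
  rw [bodyFrame, fromBlocks_transpose, fromBlocks_multiply]
  simp [h.rotation_transpose_mul ht]

theorem IsVehicle.transpose_mul_bodyFrame (h : IsVehicle g R v ω a) (ht : 0 ≤ t) :
    (bodyFrame R t)ᵀ * bodyFrame R t = 1 :=
  mul_eq_one_comm.1 (h.bodyFrame_mul_transpose ht)

/-- The C*-identity `‖Tᵀ T‖ = ‖T‖²` applied to an orthogonal matrix. -/
theorem IsVehicle.norm_bodyFrame (h : IsVehicle g R v ω a) (ht : 0 ≤ t) :
    ‖bodyFrame R t‖ = 1 := by
  have h1 := l2_opNorm_conjTranspose_mul_self (bodyFrame R t)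
  rw [conjTranspose_eq_transpose_of_trivial, h.transpose_mul_bodyFrame ht, norm_one] at h1
  nlinarith [norm_nonneg (bodyFrame R t)]

theorem IsVehicle.hasDerivWithinAt_bodyFrame (h : IsVehicle g R v ω a) (ht : 0 ≤ t) :
    HasDerivWithinAt (bodyFrame R)
      (Matrix.fromBlocks (-skew (ω t)) 0 0 (-skew (ω t)) * bodyFrame R t) (Ici 0) t := by
  have h1 := h.hasDerivWithinAt_transpose ht
  have h2 := HasDerivWithinAt.fromBlocks h1 (hasDerivWithinAt_const t (Ici 0) (0 : M3))
    (hasDerivWithinAt_const t (Ici 0) (0 : M3)) h1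
  refine h2.congr_deriv ?_
  simp [bodyFrame, fromBlocks_multiply]

/-- The transition matrix of the error dynamics. -/
def transition (R : ℝ → M3) (s t : ℝ) : Matrix I6 I6 ℝ :=
  bodyFrame R s * doubleIntegrator (s - t) * (bodyFrame R t)ᵀ

/-- The transition matrix of the adjoint of the error dynamics. -/
def adjointTransition (R : ℝ → M3) (s t : ℝ) : Matrix I6 I6 ℝ :=
  bodyFrame R s * adjointIntegrator (s - t) * (bodyFrame R t)ᵀ

/-- The frame contributes the diagonal blocks `-ω^×`. The integrator contributes the identity block,
which commutes past the frame because both diagonal blocks of the frame are `Rᵀ`. -/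
theorem IsVehicle.hasDerivWithinAt_transition (h : IsVehicle g R v ω a) (ht : 0 ≤ t) {s : ℝ}
    (hs : t ≤ s) : HasDerivWithinAt (fun r => transition R r t)
      (stateMat ω s * transition R s t) (Ici t) s := by
  have h1 := (h.hasDerivWithinAt_bodyFrame (ht.trans hs)).mono (Ici_subset_Ici.2 ht)
  have h2 := HasDerivWithinAt.matrixMul (HasDerivWithinAt.matrixMul h1
    (hasDerivWithinAt_doubleIntegrator t)) (hasDerivWithinAt_const s (Ici t) (bodyFrame R t)ᵀ)
  refine h2.congr_deriv ?_
  rw [Matrix.mul_zero, add_zero, transition, ← Matrix.mul_assoc, ← Matrix.mul_assoc]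
  congr 1
  simp [stateMat, bodyFrame, doubleIntegrator, fromBlocks_multiply, fromBlocks_add]

/-- As `ω^×` is skew-symmetric, `-Aᵀ` has the same diagonal blocks as `A`, so the same change of
frame reduces the adjoint system to its integrator. -/
theorem IsVehicle.hasDerivWithinAt_adjointTransition (h : IsVehicle g R v ω a) (ht : 0 ≤ t)
    {s : ℝ} (hs : t ≤ s) : HasDerivWithinAt (fun r => adjointTransition R r t)
      (-(stateMat ω s)ᵀ * adjointTransition R s t) (Ici t) s := by
  have h1 := (h.hasDerivWithinAt_bodyFrame (ht.trans hs)).mono (Ici_subset_Ici.2 ht)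
  have h2 := HasDerivWithinAt.matrixMul (HasDerivWithinAt.matrixMul h1
    (hasDerivWithinAt_adjointIntegrator t)) (hasDerivWithinAt_const s (Ici t) (bodyFrame R t)ᵀ)
  refine h2.congr_deriv ?_
  rw [Matrix.mul_zero, add_zero, adjointTransition, ← Matrix.mul_assoc, ← Matrix.mul_assoc]
  congr 1
  simp [stateMat, bodyFrame, adjointIntegrator, fromBlocks_multiply, fromBlocks_add,
    fromBlocks_transpose, fromBlocks_neg, skew_transpose]
  exact add_comm _ _

theorem IsVehicle.isTransitionMatrix (h : IsVehicle g R v ω a) :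
    IsTransitionMatrix (stateMat ω) (transition R) := by
  refine fun t ht => ⟨?_, fun s hs => hasMatDerivWithinAt_iff.2
    (h.hasDerivWithinAt_transition ht hs)⟩
  have e : doubleIntegrator 0 = 1 := by simp [doubleIntegrator]
  rw [transition, sub_self, e, Matrix.mul_one, h.bodyFrame_mul_transpose ht]

theorem IsVehicle.adjointTransition_mul_transpose (h : IsVehicle g R v ω a) (ht : 0 ≤ t) {s : ℝ}
    (hs : t ≤ s) : adjointTransition R s t * (transition R s t)ᵀ = 1 := by
  rw [adjointTransition, transition, transpose_mul, transpose_mul, transpose_transpose]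
  calc _ = bodyFrame R s * (adjointIntegrator (s - t) * ((bodyFrame R t)ᵀ * bodyFrame R t) *
        (doubleIntegrator (s - t))ᵀ) * (bodyFrame R s)ᵀ := by simp only [Matrix.mul_assoc]
    _ = 1 := by
      rw [h.transpose_mul_bodyFrame ht, Matrix.mul_one, adjointIntegrator_mul_transpose,
        Matrix.mul_one, h.bodyFrame_mul_transpose (ht.trans hs)]

theorem IsVehicle.norm_conj_le (h : IsVehicle g R v ω a) {s : ℝ} (ht : 0 ≤ t) (hs : 0 ≤ s)
    (X : Matrix I6 I6 ℝ) : ‖bodyFrame R s * X * (bodyFrame R t)ᵀ‖ ≤ ‖X‖ := by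
  refine (l2_opNorm_mul _ _).trans ?_
  rw [norm_transpose, h.norm_bodyFrame ht, mul_one]
  refine (l2_opNorm_mul _ _).trans ?_
  rw [h.norm_bodyFrame hs, one_mul]

theorem IsVehicle.proj_bodyDir_mul (h : IsVehicle g R v ω a) (hv : ∀ t, 0 ≤ t → v t ≠ 0)
    (ht : 0 ≤ t) : proj (bodyDir R v t) * (R t)ᵀ = (R t)ᵀ * proj (inertialDir R v t) := by
  rw [proj_of_unit (h.bodyDir_unit hv ht), proj_of_unit (h.inertialDir_unit hv ht),
    h.bodyDir_eq ht, sub_mul, mul_sub, Matrix.one_mul, Matrix.mul_one, vecMulVec_mul,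
    mul_vecMulVec, vecMul_transpose, mulVec_mulVec, h.rotation_mul_transpose ht, one_mulVec]

/-- The projection passes through the rotation, which turns the body direction into the inertial
one. The remaining factor `(R s)ᵀ` is an isometry and disappears from the Gramian. -/
theorem IsVehicle.output_transition (h : IsVehicle g R v ω a) (hv : ∀ t, 0 ≤ t → v t ≠ 0)
    {s : ℝ} (hs : 0 ≤ s) (α β : V3) (r : ℝ) :
    (outputMat (bodyDir R v) s) *ᵥ (bodyFrame R s *ᵥ (doubleIntegrator r *ᵥ Sum.elim α β)) =
      (R s)ᵀ *ᵥ (proj (inertialDir R v s) *ᵥ (α + r • β)) := by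
  rw [mulVec_mulVec (α + r • β), ← h.proj_bodyDir_mul hv hs, outputMat, bodyFrame,
    doubleIntegrator]
  simp [fromBlocks_mulVec, fromCols_mulVec, smul_mulVec]

theorem orthogonal_dotProduct {n : Type*} [Fintype n] [DecidableEq n] {Q : Matrix n n ℝ}
    (hQ : Qᵀ * Q = 1) (x y : n → ℝ) : (Q *ᵥ x) ⬝ᵥ (Q *ᵥ y) = x ⬝ᵥ y := by
  rw [← transpose_quadForm, mulVec_mulVec, hQ, one_mulVec, dotProduct_comm]

/-- Uniform observability with the explicit transition matrix, together with the controllability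
of the adjoint system. -/
theorem IsVehicle.observable (h : IsVehicle g R v ω a) (hv : ∀ t, 0 ≤ t → v t ≠ 0)
    (hPE : PersistentlyExciting (inertialDir R v)) :
    ∃ δ μ : ℝ, 0 < δ ∧ 0 < μ ∧ ∀ t, 0 ≤ t →
      (gramian (transition R) (outputMat (bodyDir R v)) δ t -
        μ • (1 : Matrix I6 I6 ℝ)).PosSemidef := by
  obtain ⟨δ, μ, hδ, hμ, hPE⟩ := hPE
  have hΓc := continuousOn_proj (h.continuousOn_inertialDir hv) fun t ht => h.inertialDir_unit hv ht
  obtain ⟨δ', κ, hδ', hκ, hex⟩ := affine_excitation (Γ := fun t => proj (inertialDir R v t)) hδ hμ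
    (fun t _ => proj_transpose _) (fun t ht => proj_mul_self (h.inertialDir_unit hv ht)) hΓc
    (fun t ht w => by
      have h1 := ((posSemidef_sub_smul_one_iff _ _).1 (hPE t ht)).2 w
      rw [smul_mulVec, dotProduct_smul, smul_eq_mul, one_div, inv_mul_eq_div, le_div_iff₀ hδ,
        quadForm_matIntegral (by linarith) (hΓc.mono
          (Icc_subset_Ici_self.trans (Ici_subset_Ici.2 ht)))] at h1
      linarith)
  -- The Gramian is an average over the window, hence the division by `δ'`.
  refine ⟨δ', κ / δ', hδ', by positivity, fun t ht => (posSemidef_sub_smul_one_iff _ _).2 ⟨?_, ?_⟩⟩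
  · rw [gramian, transpose_smul, matIntegral_transpose]
    simp only [Matrix.transpose_mul, transpose_transpose, Matrix.mul_assoc]
  · intro x
    have hTt := h.bodyFrame_mul_transpose ht
    obtain ⟨α, β, hαβ⟩ : ∃ α β : V3, (bodyFrame R t)ᵀ *ᵥ x = Sum.elim α β :=
      ⟨_, _, (Sum.elim_comp_inl_inr _).symm⟩
    have hx : x ⬝ᵥ x = α ⬝ᵥ α + β ⬝ᵥ β := by
      rw [← sumElim_dotProduct_sumElim, ← hαβ,
        orthogonal_dotProduct (by rwa [transpose_transpose])]
    have hΦc : ContinuousOn (fun s => transition R s t) (Icc t (t + δ')) := fun s hs =>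
      (h.hasDerivWithinAt_transition ht hs.1).continuousWithinAt.mono Icc_subset_Ici_self
    have hCc : ContinuousOn (outputMat (bodyDir R v)) (Icc t (t + δ')) :=
      (continuousOn_outputMat (h.continuousOn_bodyDir hv) fun t ht => h.bodyDir_unit hv ht).mono
        (Icc_subset_Ici_self.trans (Ici_subset_Ici.2 ht))
    rw [gramian, smul_mulVec, dotProduct_smul, smul_eq_mul, quadForm_matIntegral (by linarith), hx]
    · have e : ∀ s ∈ uIcc t (t + δ'), x ⬝ᵥ ((transition R s t)ᵀ * (outputMat (bodyDir R v) s)ᵀ *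
          outputMat (bodyDir R v) s * transition R s t) *ᵥ x =
          (proj (inertialDir R v s) *ᵥ (α + (s - t) • β)) ⬝ᵥ
            (proj (inertialDir R v s) *ᵥ (α + (s - t) • β)) := by
        intro s hs
        rw [uIcc_of_le (by linarith)] at hs
        have hs0 : 0 ≤ s := ht.trans hs.1
        have e1 : outputMat (bodyDir R v) s *ᵥ (transition R s t *ᵥ x) =
            (R s)ᵀ *ᵥ (proj (inertialDir R v s) *ᵥ (α + (s - t) • β)) := by
          rw [← h.output_transition hv hs0, ← hαβ, transition]
          simp only [mulVec_mulVec, Matrix.mul_assoc]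
        simp only [← mulVec_mulVec]
        rw [transpose_quadForm, dotProduct_comm, transpose_quadForm, e1,
          orthogonal_dotProduct (by rw [transpose_transpose]; exact h.rotation_mul_transpose hs0)]
      rw [intervalIntegral.integral_congr e, one_div, div_mul_eq_mul_div, inv_mul_eq_div]
      exact div_le_div_of_nonneg_right (hex t ht α β) hδ'.le
    · rw [continuousOn_iff_continuous_domRestrict] at *
      exact ((hΦc.matrix_transpose.matrix_mul hCc.matrix_transpose).matrix_mul hCc).matrix_mul hΦc

/-- The bounds on the two transition matrices are uniform in `t`: up to isometries these matrices
depend only on `s - t`, which stays in the compact interval `[0, δ]`. -/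
theorem IsVehicle.adjointControllable (h : IsVehicle g R v ω a) (hv : ∀ t, 0 ≤ t → v t ≠ 0)
    (hPE : PersistentlyExciting (inertialDir R v)) :
    ∃ δ : ℝ, 0 < δ ∧ AdjointControllable (stateMat ω) (outputMat (bodyDir R v)) δ := by
  obtain ⟨δ, μ, hδ, hμ, hG⟩ := h.observable hv hPE
  obtain ⟨B₁, hB₁⟩ := isCompact_Icc.exists_bound_of_continuousOn (s := Icc 0 δ)
    continuous_doubleIntegrator.continuousOn
  obtain ⟨B₂, hB₂⟩ := isCompact_Icc.exists_bound_of_continuousOn (s := Icc 0 δ)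
    continuous_adjointIntegrator.continuousOn
  have hB₁0 : 0 ≤ B₁ := (norm_nonneg _).trans (hB₁ 0 ⟨le_rfl, hδ.le⟩)
  refine ⟨δ, hδ, AdjointControllable.of_gramian (Φ := transition R) (Ψ := adjointTransition R)
    (B := max B₁ B₂) hδ hμ (hB₁0.trans (le_max_left _ _))
    (boundedMat_outputMat fun t ht => h.bodyDir_unit hv ht)
    (continuousOn_outputMat (h.continuousOn_bodyDir hv) fun t ht => h.bodyDir_unit hv ht)
    (fun t ht s hs => (h.hasDerivWithinAt_transition ht hs).continuousWithinAt)
    (fun t ht s hs => h.hasDerivWithinAt_adjointTransition ht hs)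
    (fun t s ht hs => h.adjointTransition_mul_transpose ht hs) ?_ ?_ hG⟩
  · intro t s ht hs
    exact (h.norm_conj_le ht (ht.trans hs.1) _).trans
      ((hB₁ _ ⟨by linarith [hs.1], by linarith [hs.2]⟩).trans (le_max_left _ _))
  · intro t s ht hs
    exact (h.norm_conj_le ht (ht.trans hs.1) _).trans
      ((hB₂ _ ⟨by linarith [hs.1], by linarith [hs.2]⟩).trans (le_max_right _ _))

end Vehicle

/-! ### Error dynamics of the observer -/

section Observer

variable {g : ℝ} {R : ℝ → M3} {v ω a : ℝ → V3} {t : ℝ}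

theorem IsVehicle.hasDerivWithinAt_bodyVel (h : IsVehicle g R v ω a) (ht : 0 ≤ t) :
    HasDerivWithinAt (bodyVel R v)
      (-(skew (ω t) *ᵥ bodyVel R v t) + a t + bodyGravity g R t) (Ici 0) t := by
  have h1 := HasDerivWithinAt.matrixMulVec (h.hasDerivWithinAt_transpose ht) (h.velocity t ht)
  refine h1.congr_deriv ?_
  rw [mulVec_add, mulVec_mulVec, h.rotation_transpose_mul ht, one_mulVec, ← mulVec_mulVec, neg_mulVec,
    bodyVel, bodyGravity, add_assoc]

theorem IsVehicle.hasDerivWithinAt_bodyGravity (h : IsVehicle g R v ω a) (ht : 0 ≤ t) :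
    HasDerivWithinAt (bodyGravity g R) (-(skew (ω t) *ᵥ bodyGravity g R t)) (Ici 0) t := by
  have h1 := HasDerivWithinAt.matrixMulVec (h.hasDerivWithinAt_transpose ht)
    (hasDerivWithinAt_const t (Ici 0) (gravity g))
  refine h1.congr_deriv ?_
  rw [mulVec_zero, add_zero, ← mulVec_mulVec, neg_mulVec, bodyGravity]

/-- The body velocity is parallel to its measured direction. Hence `-π_η v̂ = π_η (v^B - v̂)`, which
makes the innovation a linear function of the error. -/
theorem IsVehicle.proj_mulVec_bodyVel (h : IsVehicle g R v ω a) (hv : ∀ t, 0 ≤ t → v t ≠ 0)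
    (ht : 0 ≤ t) : proj (bodyDir R v t) *ᵥ bodyVel R v t = 0 := by
  have hp := eucNorm_pos (hv t ht)
  have e : bodyVel R v t = eucNorm (v t) • bodyDir R v t := by
    rw [bodyVel, bodyDir, mulVec_smul, smul_smul, mul_one_div_cancel hp.ne', one_smul]
  rw [e, mulVec_smul, proj_of_unit (h.bodyDir_unit hv ht), sub_mulVec, one_mulVec,
    vecMulVec_mulVec, h.bodyDir_unit hv ht]
  simp

theorem hasDerivWithinAt_sumElim {x y : ℝ → V3} {w : I6 → ℝ} {s : Set ℝ} :
    HasDerivWithinAt (fun r => Sum.elim (x r) (y r)) w s t ↔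
      HasDerivWithinAt x (w ∘ Sum.inl) s t ∧ HasDerivWithinAt y (w ∘ Sum.inr) s t := by
  simp only [hasDerivWithinAt_pi, Sum.forall, Sum.elim_inl, Sum.elim_inr, Function.comp_apply]

theorem hasDerivWithinAt_sub_iff {x y : ℝ → V3} {x' y' : V3} {s : Set ℝ}
    (hx : HasDerivWithinAt x x' s t) :
    HasDerivWithinAt (fun r => x r - y r) (x' - y') s t ↔ HasDerivWithinAt y y' s t := by
  refine ⟨fun h => ?_, fun h => hx.fun_sub h⟩
  simpa using hx.fun_sub h

theorem closedLoop_mulVec (ω η : ℝ → V3) (K : ℝ → Matrix I6 (Fin 3) ℝ) (t : ℝ) (x₁ x₂ : V3) :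
    (stateMat ω t - K t * outputMat η t) *ᵥ Sum.elim x₁ x₂ =
      Sum.elim (-(skew (ω t) *ᵥ x₁) + x₂ - (K t).toRows₁ *ᵥ (proj (η t) *ᵥ x₁))
        (-(skew (ω t) *ᵥ x₂) - (K t).toRows₂ *ᵥ (proj (η t) *ᵥ x₁)) := by
  have e : K t *ᵥ (proj (η t) *ᵥ x₁) = Sum.elim ((K t).toRows₁ *ᵥ (proj (η t) *ᵥ x₁))
      ((K t).toRows₂ *ᵥ (proj (η t) *ᵥ x₁)) := by
    conv_lhs => rw [← fromRows_toRows (K t), fromRows_mulVec]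
  rw [sub_mulVec, ← mulVec_mulVec, stateMat, outputMat, fromBlocks_mulVec, fromCols_mulVec]
  simp only [Sum.elim_comp_inl, Sum.elim_comp_inr, zero_mulVec, add_zero, zero_add, one_mulVec,
    neg_mulVec, e]
  ext (i | i) <;> simp

theorem IsVehicle.observerTrajectory_iff (h : IsVehicle g R v ω a) (hv : ∀ t, 0 ≤ t → v t ≠ 0)
    (K : ℝ → Matrix I6 (Fin 3) ℝ) (vhat z : ℝ → V3) {t₀ t₁ : ℝ} (ht₀ : 0 ≤ t₀) :
    IsObserverTrajectory ω a (bodyDir R v) K vhat z t₀ t₁ ↔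
      IsSolutionOn (fun t => stateMat ω t - K t * outputMat (bodyDir R v) t)
        (observerError g R v vhat z) t₀ t₁ := by
  refine forall₂_congr fun t ht => ?_
  have ht0 : 0 ≤ t := ht₀.trans ht.1
  have hsub : Icc t₀ t₁ ⊆ Ici 0 := Icc_subset_Ici_self.trans (Ici_subset_Ici.2 ht₀)
  have hπ := h.proj_mulVec_bodyVel hv ht0
  have hV := (h.hasDerivWithinAt_bodyVel ht0).mono hsub
  have hG := (h.hasDerivWithinAt_bodyGravity ht0).mono hsub
  have e := closedLoop_mulVec ω (bodyDir R v) K t (bodyVel R v t - vhat t)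
    (bodyGravity g R t - z t)
  have ex : observerError g R v vhat z t =
    Sum.elim (bodyVel R v t - vhat t) (bodyGravity g R t - z t) := rfl
  -- The true `v^B` and `g^B` are differentiable with known derivatives, so differentiating the
  -- estimates is equivalent to differentiating the errors; this gives both directions at once.
  rw [← hasDerivWithinAt_sub_iff (y := vhat) hV, ← hasDerivWithinAt_sub_iff (y := z) hG, ex, e]
  refine Iff.trans ?_ hasDerivWithinAt_sumElim.symm
  rw [Sum.elim_comp_inl, Sum.elim_comp_inr]
  refine and_congr (iff_of_eq (congrArg (fun w => HasDerivWithinAt _ w _ _) ?_))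
    (iff_of_eq (congrArg (fun w => HasDerivWithinAt _ w _ _) ?_))
  · simp only [mulVec_sub, mulVec_neg, hπ, mulVec_zero]
    abel
  · simp only [mulVec_sub, mulVec_neg, hπ, mulVec_zero]
    abel

end Observer

end Odometry

theorem lemma2 (g : ℝ) (R : ℝ → Odometry.M3) (v ω a : ℝ → Odometry.V3)
    (hveh : Odometry.IsVehicle g R v ω a)
    (hv_ne : ∀ t, 0 ≤ t → v t ≠ 0)
    (hv_cont : ContinuousOn (Odometry.bodyVel R v) (Set.Ici 0))
    (hv_bdd : Odometry.BoundedVec (Odometry.bodyVel R v))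
    (hω_cont : ContinuousOn ω (Set.Ici 0))
    (hω_bdd : Odometry.BoundedVec ω)
    (hPE : Odometry.PersistentlyExciting (Odometry.inertialDir R v)) :
    Odometry.UniformlyObservable (Odometry.stateMat ω) (Odometry.outputMat (Odometry.bodyDir R v)) ∧
    ∀ (S : ℝ → Matrix Odometry.I6 Odometry.I6 ℝ) (D : ℝ → Odometry.M3) (P : ℝ → Matrix Odometry.I6 Odometry.I6 ℝ),
      Odometry.IsWeight S → Odometry.IsWeight D →
      Odometry.IsRiccatiSolution (Odometry.stateMat ω) (Odometry.outputMat (Odometry.bodyDir R v)) S D P →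
      -- the closed-loop error system `ẋ = (A - K C) x` is globally exponentially stable
      Odometry.GloballyExponentiallyStable
        (fun t => Odometry.stateMat ω t -
          Odometry.gain (Odometry.outputMat (Odometry.bodyDir R v)) D P t * Odometry.outputMat (Odometry.bodyDir R v) t) ∧
      -- and it is the system that governs the error of the observer
      ∀ (vhat z : ℝ → Odometry.V3) (t₀ t₁ : ℝ), 0 ≤ t₀ →
        (Odometry.IsObserverTrajectory ω a (Odometry.bodyDir R v)
            (Odometry.gain (Odometry.outputMat (Odometry.bodyDir R v)) D P) vhat z t₀ t₁ ↔
          Odometry.IsSolutionOn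
            (fun t => Odometry.stateMat ω t -
              Odometry.gain (Odometry.outputMat (Odometry.bodyDir R v)) D P t *
                Odometry.outputMat (Odometry.bodyDir R v) t)
            (Odometry.observerError g R v vhat z) t₀ t₁) := by
  have hη : ∀ t, 0 ≤ t →
      Odometry.bodyDir R v t ⬝ᵥ Odometry.bodyDir R v t = 1 := fun t ht => hveh.bodyDir_unit hv_ne ht
  refine ⟨⟨_, hveh.isTransitionMatrix, hveh.observable hv_ne hPE⟩, fun S D P hS hD hP => ⟨?_, ?_⟩⟩
  · obtain ⟨δ, hδ, hctrl⟩ := hveh.adjointControllable hv_ne hPE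
    exact hP.globallyExponentiallyStable (Odometry.boundedMat_stateMat hω_bdd)
      (Odometry.boundedMat_outputMat hη) hS hD hδ hctrl
  · exact fun vhat z t₀ t₁ ht₀ => hveh.observerTrajectory_iff hv_ne _ vhat z ht₀
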